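/- Let $d\ge 1$ be an integer, let $d\sigma(x)=(2\pi)^{-d/2}e^{-|x|^2/2}\,dx$ be the normalized Gaussian measure on $\mathbb R^d$, and let $p\in[1,2)$. For $q\ge1$ write $\|\cdot\|_q$ for the norm of $L^q(\mathbb R^d,d\sigma)$, with $\|\nabla f\|_q=\|\,|\nabla f|\,\|_q$ and $|\cdot|$ the Euclidean norm. Let $\mathrm H^1(\mathbb R^d,d\sigma)$ be the space of real-valued functions $f\in L^2(\mathbb R^d,d\sigma)$ whose weak gradient $\nabla f$ belongs to $L^2(\mathbb R^d,d\sigma)$. For every $f\in\mathrm H^1(\mathbb R^d,d\sigma)$ such that $$\int_{\mathbb R^d}x\,f(x)\,d\sigma=0,$$ one has $$\|\nabla f\|_2^2-\frac1{2-p}\left(\|f\|_2^2-\|f\|_p^2\right)\ge\frac{2-p}2\,\|\nabla f\|_2^2 .$$ -/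

import Mathlib

open MeasureTheory
open scoped ContDiff ENNReal

/-- The normalized Gaussian measure `dσ(x) = (2π)^(-d/2) exp(-|x|²/2) dx` on `ℝ^d`. -/
noncomputable def normalizedGaussian (d : ℕ) : Measure (EuclideanSpace ℝ (Fin d)) :=
  volume.withDensity fun x =>
    ENNReal.ofReal ((2 * Real.pi) ^ (-(d : ℝ) / 2) * Real.exp (-(‖x‖ ^ 2) / 2))

/-- `g` is the weak (distributional) gradient of `f` on `ℝ^d`: both are locally integrable for the
Lebesgue measure and `∫ f ∂ᵥφ dx = - ∫ (g · v) φ dx` for every smooth compactly supported test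
function `φ` and every direction `v`. -/
structure HasWeakGradient {d : ℕ} (f : EuclideanSpace ℝ (Fin d) → ℝ)
    (g : EuclideanSpace ℝ (Fin d) → EuclideanSpace ℝ (Fin d)) : Prop where
  locallyIntegrable : LocallyIntegrable f volume
  locallyIntegrable_grad : LocallyIntegrable g volume
  integral_eq : ∀ φ : EuclideanSpace ℝ (Fin d) → ℝ, ContDiff ℝ ∞ φ → HasCompactSupport φ →
    ∀ v : EuclideanSpace ℝ (Fin d),
      ∫ x, f x * fderiv ℝ φ x v = - ∫ x, inner ℝ (g x) v * φ x

/-- The Sobolev space `H¹(ℝ^d, dσ)`: functions in `L²(dσ)` with a weak gradient in `L²(dσ)`. -/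
def MemGaussianH1 {d : ℕ} (f : EuclideanSpace ℝ (Fin d) → ℝ) : Prop :=
  MemLp f 2 (normalizedGaussian d) ∧
    ∃ g : EuclideanSpace ℝ (Fin d) → EuclideanSpace ℝ (Fin d),
      HasWeakGradient f g ∧ MemLp g 2 (normalizedGaussian d)

/-!
Write `c = p - 1 ∈ [0, 1)`. Let `f = ∑ f_k` be the Hermite expansion of `f`. Gaussian
hypercontractivity gives `∑ c ^ k ‖f_k‖² ≤ ‖f‖_p²`, hence `‖f‖_2² - ‖f‖_p² ≤ ∑ (1 - c ^ k) ‖f_k‖²`,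
while `‖∇f‖_2² = ∑ k ‖f_k‖²`. The ratio `(1 - c ^ k) / k` decreases in `k`, and orthogonality to the
coordinate functions removes the level `k = 1`, so the constant `1 - c` of Beckner's inequality
improves to the value `(1 - c²) / 2 = p (2 - p) / 2` at `k = 2`. Dividing by `2 - p` gives the claim.

The argument is carried out on the discrete cube `{±1}^N`, where the Hermite levels become the
levels of the Fourier-Walsh expansion and everything is a finite sum. A two-point inequality
(`isHypercontractive_units`) tensorizes to hypercontractivity of the kernel
`∏ i, (1 + c x_i y_i)` (`isHypercontractive_noiseKernel`), and expanding the product diagonalizes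
the corresponding quadratic form (`expect_noiseKernel_mul`). This gives `cube_beckner`, in which the
contribution of level `1` is kept as an error term. Applied to `u ∘ S` for a smooth compactly
supported `u`, where `S` is a normalized sum of `n` independent vectors of signs, it becomes the
Gaussian inequality `gaussian_beckner_of_contDiff` as `n → ∞`: the central limit theorem
(`tendsto_expect_cubeSum`, through characteristic functions) handles the integrals, and Taylor's
formula turns discrete derivatives into the gradient. Finally, smooth compactly supported functions
are dense in the Gaussian Sobolev space (`HasWeakGradient.exists_contDiff_approx_gaussian`: cutoff,
then mollification), the level-one term is continuous in `L²` and vanishes in the limit, and weak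
gradients are unique almost everywhere (`HasWeakGradient.ae_eq`).
-/

open scoped BigOperators Topology
open Filter

/-! ### The two-point inequality -/

lemma two_mul_mul_le_rpow_sub_rpow {s t : ℝ} (hs0 : 0 ≤ s) (hs1 : s ≤ 1) (ht0 : 0 ≤ t)
    (ht1 : t < 1) : 2 * s * t ≤ (1 + t) ^ s - (1 - t) ^ s := by
  have hd : ∀ x ∈ Set.Ico (0 : ℝ) 1, HasDerivAt
      (fun x : ℝ => (1 + x) ^ s - (1 - x) ^ s - 2 * s * x)
      (s * ((1 + x) ^ (s - 1) + (1 - x) ^ (s - 1)) - 2 * s) x := by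
    intro x hx
    have h1 := ((hasDerivAt_id x).const_add 1).rpow_const (p := s)
      (Or.inl (by simp only [id]; linarith [hx.1]))
    have h2 := ((hasDerivAt_id x).const_sub 1).rpow_const (p := s)
      (Or.inl (by simp only [id]; linarith [hx.2]))
    refine ((h1.sub h2).sub ((hasDerivAt_id x).const_mul (2 * s))).congr_deriv ?_
    simp only [id]; ring
  have hmono : MonotoneOn (fun x : ℝ => (1 + x) ^ s - (1 - x) ^ s - 2 * s * x)
      (Set.Ico (0 : ℝ) 1) := by
    refine monotoneOn_of_deriv_nonneg (convex_Ico 0 1)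
      (fun x hx => (hd x hx).continuousAt.continuousWithinAt)
      (fun x hx => (hd x (interior_subset hx)).differentiableAt.differentiableWithinAt) ?_
    intro x hx
    have hx' := interior_subset hx
    rw [(hd x hx').deriv]
    have hx0 := hx'.1
    have hx1 := hx'.2
    -- By the arithmetic-geometric mean inequality the derivative is nonnegative, since
    -- `(1 - x ^ 2) ^ (s - 1) ≥ 1`.
    have hprod : 1 ≤ (1 + x) ^ (s - 1) * (1 - x) ^ (s - 1) := by
      rw [← Real.mul_rpow (by linarith) (by linarith)]
      exact Real.one_le_rpow_of_pos_of_le_one_of_nonpos (by nlinarith) (by nlinarith) (by linarith)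
    have ha : 0 < (1 + x) ^ (s - 1) := Real.rpow_pos_of_pos (by linarith) _
    have hb : 0 < (1 - x) ^ (s - 1) := Real.rpow_pos_of_pos (by linarith) _
    have : 2 ≤ (1 + x) ^ (s - 1) + (1 - x) ^ (s - 1) := by
      nlinarith [sq_nonneg ((1 + x) ^ (s - 1) - (1 - x) ^ (s - 1))]
    nlinarith
  have := hmono (Set.left_mem_Ico.2 one_pos) ⟨ht0, ht1⟩ ht0
  simp only [add_zero, sub_zero, mul_zero, Real.one_rpow] at this
  linarith

/-- The even part of `(1 + t) ^ p` dominates its second order Taylor polynomial. -/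
lemma one_add_mul_sq_le {p t : ℝ} (hp1 : 1 ≤ p) (hp2 : p ≤ 2) (ht0 : 0 ≤ t) (ht1 : t ≤ 1) :
    1 + p / 2 * ((p - 1) * t ^ 2) ≤ ((1 + t) ^ p + (1 - t) ^ p) / 2 := by
  have hd : ∀ x : ℝ, HasDerivAt
      (fun x : ℝ => ((1 + x) ^ p + (1 - x) ^ p) / 2 - p / 2 * ((p - 1) * x ^ 2))
      (p / 2 * ((1 + x) ^ (p - 1) - (1 - x) ^ (p - 1) - 2 * (p - 1) * x)) x := by
    intro x
    have h1 := ((hasDerivAt_id x).const_add 1).rpow_const (p := p) (Or.inr hp1)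
    have h2 := ((hasDerivAt_id x).const_sub 1).rpow_const (p := p) (Or.inr hp1)
    refine (((h1.add h2).div_const 2).sub
      (((hasDerivAt_pow 2 x).const_mul (p - 1)).const_mul (p / 2))).congr_deriv ?_
    simp only [id]; push_cast; ring
  have hmono : MonotoneOn
      (fun x : ℝ => ((1 + x) ^ p + (1 - x) ^ p) / 2 - p / 2 * ((p - 1) * x ^ 2))
      (Set.Icc (0 : ℝ) 1) := by
    refine monotoneOn_of_deriv_nonneg (convex_Icc 0 1)
      (fun x hx => (hd x).continuousAt.continuousWithinAt)
      (fun x hx => (hd x).differentiableAt.differentiableWithinAt) ?_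
    intro x hx
    rw [interior_Icc] at hx
    rw [(hd x).deriv]
    have := two_mul_mul_le_rpow_sub_rpow (s := p - 1) (by linarith) (by linarith) hx.1.le hx.2
    exact mul_nonneg (by linarith) (by linarith)
  have := hmono (Set.left_mem_Icc.2 zero_le_one) ⟨ht0, ht1⟩ ht0
  simp only [add_zero, sub_zero, Real.one_rpow] at this
  norm_num at this
  linarith

/-- Two-point hypercontractivity, from `L^p` to `L^2`, for the function with values `m ± t`. After
normalizing to `m = 1` it follows from Bernoulli's inequality and `one_add_mul_sq_le`. -/
lemma rpow_sq_add_mul_sq_le {p m t : ℝ} (hp1 : 1 ≤ p) (hp2 : p ≤ 2) (htm : |t| ≤ m) :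
    (m ^ 2 + (p - 1) * t ^ 2) ^ (p / 2) ≤ ((m + t) ^ p + (m - t) ^ p) / 2 := by
  wlog ht0 : 0 ≤ t generalizing t
  · have := this (t := -t) (by rwa [abs_neg]) (by linarith)
    rw [neg_sq, ← sub_eq_add_neg, sub_neg_eq_add, add_comm ((m - t) ^ p)] at this
    exact this
  rw [abs_of_nonneg ht0] at htm
  rcases (ht0.trans htm).eq_or_lt with hm | hm
  · have : t = 0 := le_antisymm (htm.trans hm.ge) ht0
    subst this; subst hm
    have h1 : p ≠ 0 := by linarith
    have h2 : p / 2 ≠ 0 := by positivity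
    simp [Real.zero_rpow h1, Real.zero_rpow h2]
  · set r := t / m with hr
    have hr0 : 0 ≤ r := by positivity
    have hr1 : r ≤ 1 := (div_le_one hm).2 htm
    have ht : t = m * r := by rw [hr]; field_simp
    have e1 : m ^ 2 + (p - 1) * t ^ 2 = m ^ 2 * (1 + (p - 1) * r ^ 2) := by rw [ht]; ring
    have e2 : m + t = m * (1 + r) := by rw [ht]; ring
    have e3 : m - t = m * (1 - r) := by rw [ht]; ring
    have hc : 0 ≤ (p - 1) * r ^ 2 := mul_nonneg (by linarith) (sq_nonneg r)
    rw [e1, e2, e3, Real.mul_rpow (by positivity) (by linarith), Real.mul_rpow hm.le (by linarith),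
      Real.mul_rpow hm.le (by linarith), ← Real.rpow_natCast m 2, ← Real.rpow_mul hm.le]
    have e4 : ((2 : ℕ) : ℝ) * (p / 2) = p := by push_cast; ring
    rw [e4]
    have h1 : (1 + (p - 1) * r ^ 2) ^ (p / 2) ≤ 1 + p / 2 * ((p - 1) * r ^ 2) :=
      rpow_one_add_le_one_add_mul_self (by linarith) (by linarith) (by linarith)
    have h2 := one_add_mul_sq_le hp1 hp2 hr0 hr1
    have := mul_le_mul_of_nonneg_left (h1.trans h2) (Real.rpow_nonneg hm.le p)
    linarith

/-! ### Hypercontractivity on the discrete cube -/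

/-- A kernel on a finite type (taken with the uniform probability) is `p`-hypercontractive if the
bilinear form it defines on nonnegative functions is bounded by the product of `L^p` norms. -/
def IsHypercontractive (p : ℝ) {α : Type*} [Fintype α] (K : α → α → ℝ) : Prop :=
  ∀ f g : α → ℝ, (∀ x, 0 ≤ f x) → (∀ x, 0 ≤ g x) →
    𝔼 x, 𝔼 y, K x y * (f x * g y) ≤ (𝔼 x, f x ^ p) ^ p⁻¹ * (𝔼 y, g y ^ p) ^ p⁻¹

/-- Tensorization of hypercontractivity: apply the bound in the second variable for fixed first
variables, then the bound in the first variable to the resulting partial `L^p` norms. -/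
lemma IsHypercontractive.prod {p : ℝ} (hp : 0 < p) {α β : Type*} [Fintype α] [Fintype β]
    {K : α → α → ℝ} {L : β → β → ℝ} (hK0 : ∀ x y, 0 ≤ K x y)
    (hK : IsHypercontractive p K) (hL : IsHypercontractive p L) :
    IsHypercontractive p fun z w : α × β => K z.1 w.1 * L z.2 w.2 := by
  intro f g hf hg
  have key : ∀ h : α × β → ℝ, (∀ z, 0 ≤ h z) → 𝔼 z, h z ^ p =
      𝔼 x, ((𝔼 x', h (x, x') ^ p) ^ p⁻¹) ^ p := by
    intro h hh
    rw [← Finset.univ_product_univ, Finset.expect_product]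
    refine Finset.expect_congr rfl fun x _ => ?_
    rw [← Real.rpow_mul (Finset.expect_nonneg fun i _ => Real.rpow_nonneg (hh _) _),
      inv_mul_cancel₀ hp.ne', Real.rpow_one]
  rw [key f hf, key g hg]
  have hF : ∀ h : α × β → ℝ, (∀ z, 0 ≤ h z) → ∀ x, 0 ≤ (𝔼 x', h (x, x') ^ p) ^ p⁻¹ :=
    fun h hh x => Real.rpow_nonneg (Finset.expect_nonneg fun i _ => Real.rpow_nonneg (hh _) _) _
  refine le_trans ?_ (hK _ _ (hF f hf) (hF g hg))
  rw [← Finset.univ_product_univ, Finset.expect_product]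
  refine Finset.expect_le_expect fun x _ => ?_
  simp_rw [Finset.expect_product]
  rw [Finset.expect_comm]
  refine Finset.expect_le_expect fun y _ => ?_
  refine le_trans (le_of_eq ?_) (mul_le_mul_of_nonneg_left
    (hL (fun x' => f (x, x')) (fun y' => g (y, y')) (fun _ => hf _) (fun _ => hg _)) (hK0 x y))
  simp_rw [Finset.mul_expect, mul_assoc]

lemma IsHypercontractive.congr_equiv {p : ℝ} {α β : Type*} [Fintype α] [Fintype β] (e : α ≃ β)
    {K : α → α → ℝ} {L : β → β → ℝ} (hKL : ∀ x y, L (e x) (e y) = K x y)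
    (hK : IsHypercontractive p K) : IsHypercontractive p L := by
  intro f g hf hg
  have h1 : ∀ F : β → ℝ, 𝔼 y, F y = 𝔼 x, F (e x) :=
    fun F => (Fintype.expect_equiv e _ _ fun _ => rfl).symm
  simp_rw [h1, hKL]
  exact hK _ _ (fun _ => hf _) (fun _ => hg _)

lemma expect_units (f : ℤˣ → ℝ) : 𝔼 x, f x = (f 1 + f (-1)) / 2 := by
  rw [Fintype.expect_eq_sum_div_card, show (Finset.univ : Finset ℤˣ) = {1, -1} from rfl,
    Finset.sum_pair (by decide)]
  norm_num

/-- The joint density, relative to the product of the uniform measures, of two vectors of signs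
whose entries are independent pairs with correlation `c`. -/
noncomputable def noiseKernel (c : ℝ) {ι : Type*} [Fintype ι] (x y : ι → ℤˣ) : ℝ :=
  ∏ i, (1 + c * (((x i : ℤ) : ℝ) * ((y i : ℤ) : ℝ)))

lemma units_coe_sq (u : ℤˣ) : ((u : ℤ) : ℝ) * ((u : ℤ) : ℝ) = 1 := by
  rcases Int.units_eq_one_or u with h | h <;> simp [h]

lemma one_add_mul_units_nonneg {c : ℝ} (h0 : 0 ≤ c) (h1 : c ≤ 1) (u v : ℤˣ) :
    0 ≤ 1 + c * (((u : ℤ) : ℝ) * ((v : ℤ) : ℝ)) := by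
  rcases Int.units_eq_one_or u with h | h <;> rcases Int.units_eq_one_or v with h' | h' <;>
    simp [h, h'] <;> linarith

lemma noiseKernel_nonneg {c : ℝ} (h0 : 0 ≤ c) (h1 : c ≤ 1) {ι : Type*} [Fintype ι]
    (x y : ι → ℤˣ) : 0 ≤ noiseKernel c x y :=
  Finset.prod_nonneg fun i _ => one_add_mul_units_nonneg h0 h1 (x i) (y i)

/-- The two-function form of two-point hypercontractivity: by Cauchy-Schwarz for the quadratic form
`m² + (p - 1) t²`, it reduces to `rpow_sq_add_mul_sq_le`. -/
lemma isHypercontractive_units {p : ℝ} (hp1 : 1 ≤ p) (hp2 : p ≤ 2) :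
    IsHypercontractive p fun u v : ℤˣ => 1 + (p - 1) * (((u : ℤ) : ℝ) * ((v : ℤ) : ℝ)) := by
  intro f g hf hg
  have hp0 : 0 < p := by linarith
  have key : ∀ h : ℤˣ → ℝ, (∀ x, 0 ≤ h x) →
      √(((h 1 + h (-1)) / 2) ^ 2 + (p - 1) * ((h 1 - h (-1)) / 2) ^ 2) ≤ (𝔼 x, h x ^ p) ^ p⁻¹ := by
    intro h hh
    have h1 := hh 1
    have h2 := hh (-1)
    have hle := rpow_sq_add_mul_sq_le (m := (h 1 + h (-1)) / 2) (t := (h 1 - h (-1)) / 2)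
      hp1 hp2 (abs_le.2 ⟨by linarith, by linarith⟩)
    rw [show (h 1 + h (-1)) / 2 + (h 1 - h (-1)) / 2 = h 1 by ring,
      show (h 1 + h (-1)) / 2 - (h 1 - h (-1)) / 2 = h (-1) by ring] at hle
    have hnn : 0 ≤ ((h 1 + h (-1)) / 2) ^ 2 + (p - 1) * ((h 1 - h (-1)) / 2) ^ 2 :=
      add_nonneg (sq_nonneg _) (mul_nonneg (by linarith) (sq_nonneg _))
    rw [expect_units, Real.sqrt_eq_rpow]
    refine le_trans (le_of_eq ?_) (Real.rpow_le_rpow (Real.rpow_nonneg hnn _) hle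
      (inv_nonneg.2 hp0.le))
    rw [← Real.rpow_mul hnn]
    congr 1
    field_simp
  refine le_trans ?_ (mul_le_mul (key f hf) (key g hg) (Real.sqrt_nonneg _)
    (Real.rpow_nonneg (Finset.expect_nonneg fun i _ => Real.rpow_nonneg (hf _) _) _))
  simp_rw [expect_units]
  set a := (f 1 + f (-1)) / 2
  set b := (f 1 - f (-1)) / 2
  set a' := (g 1 + g (-1)) / 2
  set b' := (g 1 - g (-1)) / 2
  have e : a * a' + (p - 1) * (b * b') ≤
      √(a ^ 2 + (p - 1) * b ^ 2) * √(a' ^ 2 + (p - 1) * b' ^ 2) := by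
    have hc : 0 ≤ p - 1 := by linarith
    rw [← Real.sqrt_mul (by positivity)]
    refine Real.le_sqrt_of_sq_le ?_
    nlinarith [mul_nonneg hc (sq_nonneg (a * b' - a' * b))]
  refine le_trans (le_of_eq ?_) e
  simp only [a, b, a', b', Units.val_one, Units.val_neg, Int.cast_one, Int.cast_neg]
  ring

/-- Hypercontractivity on the discrete cube, with correlation `p - 1`. -/
lemma isHypercontractive_noiseKernel {p : ℝ} (hp1 : 1 ≤ p) (hp2 : p ≤ 2)
    (ι : Type*) [Fintype ι] [DecidableEq ι] :
    IsHypercontractive p (noiseKernel (p - 1) : (ι → ℤˣ) → (ι → ℤˣ) → ℝ) := by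
  classical
  have hp0 : 0 < p := by linarith
  refine Fintype.induction_empty_option (P := fun ι [Fintype ι] => ∀ [DecidableEq ι],
    IsHypercontractive p (noiseKernel (p - 1) : (ι → ℤˣ) → (ι → ℤˣ) → ℝ)) ?_ ?_ ?_ ι
  · intro α β _ e ih _
    classical
    let _ : Fintype α := Fintype.ofEquiv β e.symm
    refine IsHypercontractive.congr_equiv (Equiv.arrowCongr e (Equiv.refl _)) ?_ ih
    intro x y
    exact Fintype.prod_equiv e.symm _ _ fun i => by simp
  · intro _ f g hf hg
    simp [noiseKernel, ← Real.rpow_mul (hf _), ← Real.rpow_mul (hg _), hp0.ne']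
  · intro α _ ih _
    classical
    refine IsHypercontractive.congr_equiv (Equiv.piOptionEquivProd (β := fun _ => ℤˣ)).symm ?_
      (IsHypercontractive.prod hp0
        (one_add_mul_units_nonneg (by linarith) (by linarith))
        (isHypercontractive_units hp1 hp2) ih)
    intro x y
    simp [noiseKernel, Fintype.prod_option, Equiv.piOptionEquivProd]

/-! ### Walsh expansion and the inequality on the discrete cube -/

section Walsh

/-- The Walsh function `x ↦ ∏ i ∈ S, x i` on the discrete cube. -/
noncomputable def walsh {ι : Type*} (S : Finset ι) (x : ι → ℤˣ) : ℝ := ∏ i ∈ S, ((x i : ℤ) : ℝ)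

lemma walsh_mul_mulSingle {ι : Type*} [DecidableEq ι] (S : Finset ι) (i : ι) (x : ι → ℤˣ) :
    walsh S (x * Pi.mulSingle i (-1)) = (if i ∈ S then -1 else 1) * walsh S x := by
  simp only [walsh, Pi.mul_apply, Units.val_mul, Int.cast_mul, Finset.prod_mul_distrib]
  rw [mul_comm]
  congr 1
  split_ifs with h
  · rw [Finset.prod_eq_single_of_mem i h]
    · simp
    · intro j _ hj
      simp [Pi.mulSingle_eq_of_ne hj]
  · refine Finset.prod_eq_one fun j hj => ?_
    have : j ≠ i := fun e => h (e ▸ hj)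
    simp [Pi.mulSingle_eq_of_ne this]

variable {ι : Type*} [Fintype ι] [DecidableEq ι]

/-- The Fourier-Walsh coefficient of `f` at `S`. -/
noncomputable def walshCoeff (f : (ι → ℤˣ) → ℝ) (S : Finset ι) : ℝ := 𝔼 x, f x * walsh S x

/-- The discrete derivative in the `i`-th direction: half the change of `f` when the `i`-th sign
is flipped. -/
noncomputable def cubeDeriv (i : ι) (f : (ι → ℤˣ) → ℝ) (x : ι → ℤˣ) : ℝ :=
  (f x - f (x * Pi.mulSingle i (-1))) / 2

/-- The Walsh functions diagonalize the noise kernel: expand the product defining it. -/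
lemma expect_noiseKernel_mul (c : ℝ) (f : (ι → ℤˣ) → ℝ) :
    𝔼 x, 𝔼 y, noiseKernel c x y * (f x * f y) = ∑ S, c ^ S.card * walshCoeff f S ^ 2 := by
  have h : ∀ x y : ι → ℤˣ, noiseKernel c x y * (f x * f y) =
      ∑ S, c ^ S.card * ((f x * walsh S x) * (f y * walsh S y)) := by
    intro x y
    rw [noiseKernel, Finset.prod_one_add, Finset.sum_mul, Finset.powerset_univ]
    refine Finset.sum_congr rfl fun S _ => ?_
    rw [Finset.prod_mul_distrib, Finset.prod_mul_distrib, Finset.prod_const, walsh, walsh]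
    ring
  simp_rw [h, Finset.expect_sum_comm, ← Finset.mul_expect, ← Finset.expect_mul, walshCoeff, sq]

/-- At correlation `1` the noise kernel is the density of the diagonal. -/
lemma noiseKernel_one (x y : ι → ℤˣ) :
    noiseKernel 1 x y = if x = y then (Fintype.card (ι → ℤˣ) : ℝ) else 0 := by
  split_ifs with h
  · subst h
    simp [noiseKernel, units_coe_sq, one_add_one_eq_two]
  · obtain ⟨i, hi⟩ := Function.ne_iff.1 h
    refine Finset.prod_eq_zero (Finset.mem_univ i) ?_
    rcases Int.units_eq_one_or (x i) with h1 | h1 <;>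
      rcases Int.units_eq_one_or (y i) with h2 | h2 <;> simp_all

/-- Parseval's identity on the discrete cube. -/
lemma expect_sq_eq_sum_walshCoeff (f : (ι → ℤˣ) → ℝ) :
    𝔼 x, f x ^ 2 = ∑ S, walshCoeff f S ^ 2 := by
  have := expect_noiseKernel_mul 1 f
  simp only [one_pow, one_mul] at this
  rw [← this]
  refine Finset.expect_congr rfl fun x _ => ?_
  rw [Fintype.expect_eq_sum_div_card]
  simp only [noiseKernel_one, ite_mul, zero_mul, Finset.sum_ite_eq, Finset.mem_univ, if_true]
  field_simp

lemma walshCoeff_cubeDeriv (i : ι) (f : (ι → ℤˣ) → ℝ) (S : Finset ι) :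
    walshCoeff (cubeDeriv i f) S = if i ∈ S then walshCoeff f S else 0 := by
  have h1 : 𝔼 x, f (x * Pi.mulSingle i (-1)) * walsh S x =
      (if i ∈ S then -1 else 1) * walshCoeff f S := by
    rw [walshCoeff, Finset.mul_expect]
    refine Fintype.expect_equiv (Equiv.mulRight (Pi.mulSingle i (-1))) _ _ fun x => ?_
    rw [Equiv.coe_mulRight, walsh_mul_mulSingle]
    split_ifs <;> ring
  have h2 : walshCoeff (cubeDeriv i f) S =
      (walshCoeff f S - 𝔼 x, f (x * Pi.mulSingle i (-1)) * walsh S x) / 2 := by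
    rw [walshCoeff, walshCoeff, ← Finset.expect_sub_distrib, Finset.expect_div]
    refine Finset.expect_congr rfl fun x _ => ?_
    rw [cubeDeriv]; ring
  rw [h2, h1]
  split_ifs <;> ring

lemma sum_expect_cubeDeriv_sq (f : (ι → ℤˣ) → ℝ) :
    ∑ i, 𝔼 x, cubeDeriv i f x ^ 2 = ∑ S : Finset ι, (S.card : ℝ) * walshCoeff f S ^ 2 := by
  simp_rw [expect_sq_eq_sum_walshCoeff, walshCoeff_cubeDeriv]
  rw [Finset.sum_comm]
  refine Finset.sum_congr rfl fun S _ => ?_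
  simp [ite_pow, Finset.sum_ite_mem]

lemma sum_walshCoeff_singleton (f : (ι → ℤˣ) → ℝ) :
    ∑ i, (𝔼 x, f x * ((x i : ℤ) : ℝ)) ^ 2 =
      ∑ S : Finset ι, if S.card = 1 then walshCoeff f S ^ 2 else 0 := by
  rw [← Finset.sum_filter]
  have : (Finset.univ.filter fun S : Finset ι => S.card = 1) =
      Finset.univ.map ⟨fun i => ({i} : Finset ι), Finset.singleton_injective⟩ := by
    ext S
    simp [Finset.card_eq_one, eq_comm]
  rw [this, Finset.sum_map]
  simp [walshCoeff, walsh]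

lemma one_sub_pow_le {c : ℝ} (h0 : 0 ≤ c) (h1 : c ≤ 1) (n : ℕ) :
    1 - c ^ (n + 2) ≤ (n + 2) * ((1 - c ^ 2) / 2) := by
  induction n with
  | zero => norm_num; linarith
  | succ n ih =>
    have h : c ^ (n + 2) ≤ c := by
      simpa using pow_le_pow_of_le_one h0 h1 (show 1 ≤ n + 2 by omega)
    have : c ^ (n + 1 + 2) = c ^ (n + 2) * c := by ring
    rw [this]
    push_cast
    nlinarith [mul_nonneg (sub_nonneg.2 h1) (sub_nonneg.2 h), sq_nonneg (1 - c)]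

/-- The improved Beckner inequality on the discrete cube, with the contribution of the first Walsh
level kept as an error term. Hypercontractivity bounds `‖f‖_p ^ 2` below by
`∑ (p - 1) ^ #S * walshCoeff f S ^ 2`; the rest is a comparison level by level. -/
theorem cube_beckner {p : ℝ} (hp1 : 1 ≤ p) (hp2 : p ≤ 2) (f : (ι → ℤˣ) → ℝ) :
    𝔼 x, f x ^ 2 - ((𝔼 x, |f x| ^ p) ^ p⁻¹) ^ 2 ≤
      p * (2 - p) / 2 * ∑ i, 𝔼 x, cubeDeriv i f x ^ 2 +
        (2 - p) ^ 2 / 2 * ∑ i, (𝔼 x, f x * ((x i : ℤ) : ℝ)) ^ 2 := by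
  have hc0 : 0 ≤ p - 1 := by linarith
  have hc1 : p - 1 ≤ 1 := by linarith
  have h1 : ∑ S, (p - 1) ^ S.card * walshCoeff f S ^ 2 ≤ ((𝔼 x, |f x| ^ p) ^ p⁻¹) ^ 2 := by
    rw [← expect_noiseKernel_mul, sq]
    refine le_trans ?_ (isHypercontractive_noiseKernel hp1 hp2 ι (fun x => |f x|) (fun x => |f x|)
      (fun _ => abs_nonneg _) fun _ => abs_nonneg _)
    refine Finset.expect_le_expect fun x _ => Finset.expect_le_expect fun y _ => ?_
    refine mul_le_mul_of_nonneg_left ?_ (noiseKernel_nonneg hc0 hc1 x y)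
    rw [← abs_mul]
    exact le_abs_self _
  refine (sub_le_sub_left h1 _).trans ?_
  rw [expect_sq_eq_sum_walshCoeff, sum_expect_cubeDeriv_sq, sum_walshCoeff_singleton,
    ← Finset.sum_sub_distrib, Finset.mul_sum, Finset.mul_sum, ← Finset.sum_add_distrib]
  refine Finset.sum_le_sum fun S _ => ?_
  -- Level `0` contributes nothing, at level `1` there is equality because
  -- `2 - p = p (2 - p) / 2 + (2 - p)² / 2`, and higher levels are covered by `one_sub_pow_le`.
  have hw : 0 ≤ walshCoeff f S ^ 2 := sq_nonneg _
  rcases h : S.card with _ | _ | n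
  · simp
  · simp only [zero_add, if_true, pow_one, Nat.cast_one, one_mul]
    refine le_of_eq ?_
    ring
  · have := mul_le_mul_of_nonneg_right (one_sub_pow_le hc0 hc1 n) hw
    rw [if_neg (by omega)]
    push_cast
    nlinarith

end Walsh

/-! ### The Gaussian measure and the central limit theorem -/

section Gaussian

variable {d : ℕ}

/-- The Lebesgue density of `normalizedGaussian d`. -/
noncomputable def gaussianDensity (d : ℕ) (x : EuclideanSpace ℝ (Fin d)) : ℝ :=
  (2 * Real.pi) ^ (-(d : ℝ) / 2) * Real.exp (-(‖x‖ ^ 2) / 2)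

lemma gaussianDensity_pos (x : EuclideanSpace ℝ (Fin d)) : 0 < gaussianDensity d x :=
  mul_pos (Real.rpow_pos_of_pos (by positivity) _) (Real.exp_pos _)

lemma continuous_gaussianDensity : Continuous (gaussianDensity d) := by
  unfold gaussianDensity
  fun_prop

lemma normalizedGaussian_eq :
    normalizedGaussian d = volume.withDensity fun x => ENNReal.ofReal (gaussianDensity d x) := rfl

lemma integral_normalizedGaussian {F : Type*} [NormedAddCommGroup F] [NormedSpace ℝ F]
    (h : EuclideanSpace ℝ (Fin d) → F) :
    ∫ x, h x ∂(normalizedGaussian d) = ∫ x, gaussianDensity d x • h x := by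
  rw [normalizedGaussian_eq, integral_withDensity_eq_integral_toReal_smul
    (continuous_gaussianDensity.measurable.ennreal_ofReal) (by simp)]
  simp [ENNReal.toReal_ofReal (gaussianDensity_pos _).le]

instance isProbabilityMeasure_normalizedGaussian (d : ℕ) :
    IsProbabilityMeasure (normalizedGaussian d) := by
  have h := GaussianFourier.integral_rexp_neg_mul_sq_norm (V := EuclideanSpace ℝ (Fin d))
    (b := 1 / 2) (by norm_num)
  have hpi : (0 : ℝ) < 2 * Real.pi := by positivity
  have h1 : ∫ x, gaussianDensity d x = 1 := by
    have : ∀ x : EuclideanSpace ℝ (Fin d), gaussianDensity d x =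
        (2 * Real.pi) ^ (-(d : ℝ) / 2) * Real.exp (-(1 / 2) * ‖x‖ ^ 2) := by
      intro x; rw [gaussianDensity]; congr 2; ring
    simp_rw [this]
    rw [integral_const_mul, h, finrank_euclideanSpace_fin,
      show Real.pi / (1 / 2) = 2 * Real.pi by ring, ← Real.rpow_add hpi]
    simp [neg_div]
  have hint : Integrable (gaussianDensity d) := by
    by_contra hn
    rw [integral_undef hn] at h1
    exact zero_ne_one h1
  constructor
  rw [normalizedGaussian_eq, withDensity_apply _ MeasurableSet.univ, Measure.restrict_univ,
    ← ofReal_integral_eq_lintegral_ofReal hint (ae_of_all _ fun x => (gaussianDensity_pos x).le),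
    h1, ENNReal.ofReal_one]

lemma charFun_normalizedGaussian (t : EuclideanSpace ℝ (Fin d)) :
    charFun (normalizedGaussian d) t = Complex.exp (-(‖t‖ ^ 2 : ℝ) / 2) := by
  have h := GaussianFourier.integral_cexp_neg_mul_sq_norm_add (V := EuclideanSpace ℝ (Fin d))
    (b := 1 / 2) (by norm_num) Complex.I t
  have hpi : (0 : ℝ) < 2 * Real.pi := by positivity
  rw [charFun_apply, integral_normalizedGaussian]
  have : ∀ x : EuclideanSpace ℝ (Fin d),
      gaussianDensity d x • Complex.exp ((inner ℝ x t : ℝ) * Complex.I) =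
      ((2 * Real.pi) ^ (-(d : ℝ) / 2) : ℝ) *
        Complex.exp (-(1 / 2) * (‖x‖ : ℂ) ^ 2 + Complex.I * (inner ℝ t x : ℝ)) := by
    intro x
    rw [gaussianDensity, Complex.real_smul, Complex.ofReal_mul, mul_assoc, Complex.ofReal_exp,
      ← Complex.exp_add, real_inner_comm]
    congr 2
    push_cast; ring
  simp_rw [this]
  rw [integral_const_mul, h, finrank_euclideanSpace_fin]
  have e : ((Real.pi : ℂ) / (1 / 2)) ^ ((d : ℂ) / 2) =
      (((2 * Real.pi) ^ ((d : ℝ) / 2) : ℝ) : ℂ) := by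
    rw [Complex.ofReal_cpow hpi.le]
    push_cast
    congr 1
    ring
  rw [e, ← mul_assoc, ← Complex.ofReal_mul, ← Real.rpow_add hpi]
  rw [show -(d : ℝ) / 2 + d / 2 = 0 by ring, Real.rpow_zero, Complex.ofReal_one, one_mul]
  congr 1
  rw [Complex.I_sq]
  push_cast
  ring

end Gaussian

section CentralLimit

/-- Independence of the coordinates under the uniform probability on a finite power. -/
lemma expect_prod_pi {𝕜 : Type*} [RCLike 𝕜] {ι α : Type*} [Fintype ι] [DecidableEq ι] [Fintype α]
    (F : ι → α → 𝕜) : 𝔼 x : ι → α, ∏ i, F i (x i) = ∏ i, 𝔼 a, F i a := by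
  simp_rw [Fintype.expect_eq_sum_div_card]
  rw [Finset.prod_div_distrib, Finset.prod_univ_sum]
  simp

/-- The normalized sum of `n` independent vectors of `d` signs, as a function from a discrete cube
to `ℝ^d`. For `n = 0` it is the junk value `0`. -/
noncomputable def cubeSum (d n : ℕ) (x : Fin d × Fin n → ℤˣ) : EuclideanSpace ℝ (Fin d) :=
  WithLp.toLp 2 fun j => (√n)⁻¹ * ∑ i, ((x (j, i) : ℤ) : ℝ)

/-- The law of `cubeSum d n` under the uniform probability on the cube. -/
noncomputable def cubeLaw (d n : ℕ) : Measure (EuclideanSpace ℝ (Fin d)) :=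
  ∑ x : Fin d × Fin n → ℤˣ,
    (Fintype.card (Fin d × Fin n → ℤˣ) : ℝ≥0∞)⁻¹ • Measure.dirac (cubeSum d n x)

instance isProbabilityMeasure_cubeLaw (d n : ℕ) : IsProbabilityMeasure (cubeLaw d n) := by
  constructor
  simp only [cubeLaw, Measure.coe_finsetSum, Finset.sum_apply, Measure.smul_apply, measure_univ,
    smul_eq_mul, mul_one, Finset.sum_const, Finset.card_univ, nsmul_eq_mul]
  exact ENNReal.mul_inv_cancel (by simp) (by simp)

lemma integral_cubeLaw {𝕜 : Type*} [RCLike 𝕜] (d n : ℕ) (h : EuclideanSpace ℝ (Fin d) → 𝕜) :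
    ∫ y, h y ∂(cubeLaw d n) = 𝔼 x, h (cubeSum d n x) := by
  rw [cubeLaw, integral_finsetSum_measure]
  · simp_rw [integral_smul_measure, integral_dirac]
    rw [Fintype.expect_eq_sum_div_card, ← Finset.smul_sum, RCLike.real_smul_eq_coe_mul,
      div_eq_inv_mul]
    congr 1
    rw [ENNReal.toReal_inv, ENNReal.toReal_natCast]
    push_cast
    rfl
  · intro x _
    exact (integrable_dirac (by simp)).smul_measure (by simp)

lemma tendsto_cos_div_sqrt_pow (t : ℝ) :
    Tendsto (fun n : ℕ => Real.cos (t * (√n)⁻¹) ^ n) atTop (𝓝 (Real.exp (-t ^ 2 / 2))) := by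
  have key : Tendsto (fun n : ℕ => (n : ℝ) * (Real.cos (t * (√n)⁻¹) - 1)) atTop
      (𝓝 (-t ^ 2 / 2)) := by
    have hlim : Tendsto (fun n : ℕ => t ^ 4 * (5 / 96) * ((n : ℝ)⁻¹)) atTop (𝓝 0) := by
      simpa using (tendsto_inv_atTop_nhds_zero_nat (𝕜 := ℝ)).const_mul (t ^ 4 * (5 / 96))
    have hsmall : Tendsto (fun n : ℕ => t * (√n)⁻¹) atTop (𝓝 0) := by
      rw [← mul_zero t]
      exact (tendsto_inv_atTop_zero.comp (Real.tendsto_sqrt_atTop.comp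
        tendsto_natCast_atTop_atTop)).const_mul t
    rw [tendsto_iff_norm_sub_tendsto_zero]
    refine squeeze_zero' (Eventually.of_forall fun _ => norm_nonneg _) ?_ hlim
    have h1 : ∀ᶠ n : ℕ in atTop, |t * (√n)⁻¹| < 1 := by
      have := hsmall.abs
      rw [abs_zero] at this
      exact this.eventually_lt_const one_pos
    filter_upwards [h1, eventually_gt_atTop 0] with n hn hn0
    have hb := Real.cos_bound hn.le
    have hnpos : (0 : ℝ) < n := Nat.cast_pos.2 hn0
    have hsq : ((√(n : ℝ))⁻¹) ^ 2 = (n : ℝ)⁻¹ := by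
      rw [inv_pow, Real.sq_sqrt hnpos.le]
    have h2 : (t * (√(n : ℝ))⁻¹) ^ 2 = t ^ 2 * (n : ℝ)⁻¹ := by rw [mul_pow, hsq]
    have h4 : |t * (√(n : ℝ))⁻¹| ^ 4 = t ^ 4 * ((n : ℝ)⁻¹) ^ 2 := by
      rw [show |t * (√(n : ℝ))⁻¹| ^ 4 = (|t * (√(n : ℝ))⁻¹| ^ 2) ^ 2 by ring, sq_abs, h2]; ring
    rw [h4, h2] at hb
    rw [Real.norm_eq_abs]
    have e : (n : ℝ) * (Real.cos (t * (√n)⁻¹) - 1) - -t ^ 2 / 2 =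
        n * (Real.cos (t * (√n)⁻¹) - (1 - t ^ 2 * (n : ℝ)⁻¹ / 2)) := by
      field_simp; ring
    rw [e, abs_mul, abs_of_pos hnpos]
    refine (mul_le_mul_of_nonneg_left hb hnpos.le).trans (le_of_eq ?_)
    field_simp
  simpa using Real.tendsto_one_add_pow_exp_of_tendsto key

lemma charFun_cubeLaw (d n : ℕ) (t : EuclideanSpace ℝ (Fin d)) :
    charFun (cubeLaw d n) t = ((∏ j, Real.cos (t j * (√n)⁻¹) ^ n : ℝ) : ℂ) := by
  rw [charFun_apply, integral_cubeLaw (𝕜 := ℂ)]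
  have h : ∀ x, Complex.exp ((inner ℝ (cubeSum d n x) t : ℝ) * Complex.I) =
      ∏ k : Fin d × Fin n, Complex.exp ((((x k : ℤ) : ℝ) * (t k.1 * (√n)⁻¹) : ℝ) * Complex.I) := by
    intro x
    rw [← Complex.exp_sum, ← Finset.sum_mul, ← Complex.ofReal_sum, Fintype.sum_prod_type]
    congr 3
    rw [PiLp.inner_apply]
    refine Finset.sum_congr rfl fun j _ => ?_
    simp only [cubeSum, RCLike.inner_apply, conj_trivial]
    rw [Finset.mul_sum, Finset.mul_sum]
    exact Finset.sum_congr rfl fun i _ => by ring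
  simp_rw [h]
  rw [expect_prod_pi (fun (k : Fin d × Fin n) (u : ℤˣ) =>
    Complex.exp ((((u : ℤ) : ℝ) * (t k.1 * (√n)⁻¹) : ℝ) * Complex.I)), Fintype.prod_prod_type]
  push_cast
  refine Finset.prod_congr rfl fun j _ => ?_
  rw [Finset.prod_const, Finset.card_univ, Fintype.card_fin]
  congr 1
  rw [Fintype.expect_eq_sum_div_card, show (Finset.univ : Finset ℤˣ) = {1, -1} from rfl,
    Finset.sum_pair (by decide), Complex.cos]
  norm_num

/-- The central limit theorem for sums of independent signs in `ℝ^d`. -/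
theorem tendsto_expect_cubeSum (d : ℕ) {h : EuclideanSpace ℝ (Fin d) → ℝ} (hc : Continuous h)
    (hb : ∃ C, ∀ x, |h x| ≤ C) :
    Tendsto (fun n : ℕ => 𝔼 x, h (cubeSum d n x)) atTop
      (𝓝 (∫ x, h x ∂(normalizedGaussian d))) := by
  obtain ⟨C, hC⟩ := hb
  let μ : ℕ → ProbabilityMeasure (EuclideanSpace ℝ (Fin d)) :=
    fun n => ⟨cubeLaw d n, inferInstance⟩
  let ν : ProbabilityMeasure (EuclideanSpace ℝ (Fin d)) := ⟨normalizedGaussian d, inferInstance⟩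
  have hweak : Tendsto μ atTop (𝓝 ν) := by
    refine ProbabilityMeasure.tendsto_of_tendsto_charFun fun t => ?_
    simp only [μ, ν, ProbabilityMeasure.coe_mk, charFun_cubeLaw, charFun_normalizedGaussian]
    have : Complex.exp (-((‖t‖ ^ 2 : ℝ) : ℂ) / 2) =
        ((∏ j, Real.exp (-(t j) ^ 2 / 2) : ℝ) : ℂ) := by
      rw [← Real.exp_sum, EuclideanSpace.real_norm_sq_eq, ← Finset.sum_div, Finset.sum_neg_distrib]
      push_cast
      rfl
    rw [this]
    exact (Complex.continuous_ofReal.tendsto _).comp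
      (tendsto_finsetProd _ fun j _ => tendsto_cos_div_sqrt_pow (t j))
  have := (ProbabilityMeasure.tendsto_iff_forall_integral_tendsto.1 hweak)
    (BoundedContinuousFunction.ofNormedAddCommGroup h hc C hC)
  simpa [μ, ν, integral_cubeLaw] using this

end CentralLimit

/-! ### The inequality for smooth compactly supported functions -/

section SmoothBeckner

/-- First order Taylor formula with a uniform quadratic remainder. -/
lemma exists_taylor_bound {E : Type*} [NormedAddCommGroup E] [NormedSpace ℝ E] {u : E → ℝ}
    (hu : ContDiff ℝ ∞ u) (hsupp : HasCompactSupport u) :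
    ∃ K, 0 ≤ K ∧ ∀ a h, |u (a - h) - u a + fderiv ℝ u a h| ≤ K * ‖h‖ ^ 2 := by
  obtain ⟨K, hK⟩ := (hu.fderiv_right (m := ∞) (by norm_num)).lipschitzWith_of_hasCompactSupport
    (hsupp.fderiv ℝ) (by simp)
  refine ⟨K, K.2, fun a h => ?_⟩
  have hd : Differentiable ℝ u := hu.differentiable (by simp)
  have := (convex_segment a (a - h)).norm_image_sub_le_of_norm_hasFDerivWithin_le'
    (f := u) (f' := fderiv ℝ u) (φ := fderiv ℝ u a) (C := K * ‖h‖)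
    (fun x _ => (hd x).hasFDerivAt.hasFDerivWithinAt) (fun x hx => ?_)
    (left_mem_segment ℝ _ _) (right_mem_segment ℝ _ _)
  · have e : a - h - a = -h := by abel
    rw [e, map_neg, sub_neg_eq_add, norm_neg, Real.norm_eq_abs] at this
    linarith
  · have h1 := hK.norm_sub_le x a
    refine h1.trans (mul_le_mul_of_nonneg_left ?_ K.2)
    obtain ⟨θ, hθ, rfl⟩ := (segment_eq_image' ℝ a (a - h)) ▸ hx
    have e : a + θ • (a - h - a) - a = -(θ • h) := by
      rw [show a - h - a = -h by abel, smul_neg]; abel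
    simp only [e, norm_neg, norm_smul, Real.norm_eq_abs, abs_of_nonneg hθ.1]
    exact mul_le_of_le_one_left (norm_nonneg _) hθ.2

variable {d : ℕ}

lemma sum_fderiv_single_sq (u : EuclideanSpace ℝ (Fin d) → ℝ) (x : EuclideanSpace ℝ (Fin d)) :
    ∑ j, fderiv ℝ u x (EuclideanSpace.single j 1) ^ 2 = ‖gradient u x‖ ^ 2 := by
  rw [EuclideanSpace.real_norm_sq_eq]
  refine Finset.sum_congr rfl fun j _ => ?_
  rw [← inner_gradient_left, EuclideanSpace.inner_single_right]
  simp

lemma cubeSum_mul_mulSingle (n : ℕ) (j : Fin d) (i : Fin n) (x : Fin d × Fin n → ℤˣ) :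
    cubeSum d n (x * Pi.mulSingle (j, i) (-1)) =
      cubeSum d n x - (2 * ((√n)⁻¹ * ((x (j, i) : ℤ) : ℝ))) • EuclideanSpace.single j 1 := by
  have hk : ∀ k : Fin d × Fin n, (((x * Pi.mulSingle (j, i) (-1) : Fin d × Fin n → ℤˣ) k : ℤ) : ℝ) =
      (((x k : ℤ) : ℝ) - if k = (j, i) then 2 * ((x (j, i) : ℤ) : ℝ) else 0) := by
    intro k
    by_cases h : k = (j, i)
    · subst h; simp; ring
    · simp [h]
  ext j'
  simp only [cubeSum, hk, PiLp.sub_apply, PiLp.smul_apply, Finset.sum_sub_distrib, smul_eq_mul,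
    PiLp.single_apply]
  by_cases h : j' = j
  · subst h; simp; ring
  · simp [h]

/-- The discrete Dirichlet form of `u ∘ cubeSum d n` is at most the mean of `‖∇u‖²` up to
`O(n ^ (-1/2))`: each of the `d * n` discrete derivatives is `± ∂_j u / √n + O(1 / n)`. -/
lemma sum_expect_cubeDeriv_comp_cubeSum_le {u : EuclideanSpace ℝ (Fin d) → ℝ}
    (hu : ContDiff ℝ ∞ u) (hsupp : HasCompactSupport u) :
    ∃ C, ∀ n : ℕ, 0 < n →
      ∑ k, 𝔼 x, cubeDeriv k (fun x => u (cubeSum d n x)) x ^ 2 ≤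
        𝔼 x, ‖gradient u (cubeSum d n x)‖ ^ 2 + C * (√n)⁻¹ := by
  obtain ⟨K, hK0, hK⟩ := exists_taylor_bound hu hsupp
  obtain ⟨L, hL⟩ := (hsupp.fderiv ℝ).exists_bound_of_continuous (hu.continuous_fderiv (by simp))
  have hL0 : 0 ≤ L := (norm_nonneg _).trans (hL 0)
  refine ⟨d * (4 * L * K + 4 * K ^ 2), fun n hn => ?_⟩
  set r : ℝ := (√n)⁻¹ with hr
  have hnpos : (0 : ℝ) < n := Nat.cast_pos.2 hn
  have hr0 : 0 ≤ r := by positivity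
  have hr2 : n * r ^ 2 = 1 := by
    rw [hr, inv_pow, Real.sq_sqrt hnpos.le]; field_simp
  have hr1 : r ≤ 1 := by
    have : (1 : ℝ) ≤ n := by exact_mod_cast hn
    exact inv_le_one_of_one_le₀ (Real.one_le_sqrt.2 this)
  have key : ∀ (j : Fin d) (i : Fin n) (x : Fin d × Fin n → ℤˣ),
      cubeDeriv (j, i) (fun x => u (cubeSum d n x)) x ^ 2 ≤
        r ^ 2 * fderiv ℝ u (cubeSum d n x) (EuclideanSpace.single j 1) ^ 2 +
          (4 * L * K + 4 * K ^ 2) * r ^ 3 := by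
    intro j i x
    set s : ℝ := ((x (j, i) : ℤ) : ℝ) with hs
    have hs2 : s ^ 2 = 1 := by rw [sq]; exact units_coe_sq _
    have hsabs : |s| = 1 := by rw [← sq_eq_sq₀ (abs_nonneg _) zero_le_one, sq_abs, hs2]; norm_num
    set D := fderiv ℝ u (cubeSum d n x) (EuclideanSpace.single j 1) with hD
    have hDL : |D| ≤ L := by
      have := (fderiv ℝ u (cubeSum d n x)).le_of_opNorm_le (hL _) (EuclideanSpace.single j 1)
      simpa using this
    have hT := hK (cubeSum d n x) ((2 * (r * s)) • EuclideanSpace.single j 1)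
    rw [map_smul, ← hD, norm_smul, Real.norm_eq_abs, abs_mul, abs_mul, hsabs, abs_of_nonneg hr0,
      smul_eq_mul] at hT
    simp only [PiLp.norm_single, norm_one, abs_two, mul_one] at hT
    have hdef : cubeDeriv (j, i) (fun x => u (cubeSum d n x)) x =
        (u (cubeSum d n x) - u (cubeSum d n x - (2 * (r * s)) • EuclideanSpace.single j 1)) / 2 := by
      rw [cubeDeriv, cubeSum_mul_mulSingle]
    set c := cubeDeriv (j, i) (fun x => u (cubeSum d n x)) x
    have h1 : |c - r * s * D| ≤ 2 * K * r ^ 2 := by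
      have e : c - r * s * D = -((u (cubeSum d n x - (2 * (r * s)) • EuclideanSpace.single j 1) -
          u (cubeSum d n x) + 2 * (r * s) * D) / 2) := by rw [hdef]; ring
      rw [e, abs_neg, abs_div, abs_two]
      linarith
    have h2 : |c| ≤ r * |D| + 2 * K * r ^ 2 := by
      have e : |r * s * D| = r * |D| := by
        rw [abs_mul, abs_mul, hsabs, abs_of_nonneg hr0, mul_one]
      have := abs_add_le (r * s * D) (c - r * s * D)
      rw [add_sub_cancel, e] at this
      linarith
    calc c ^ 2 = |c| ^ 2 := (sq_abs c).symm
      _ ≤ (r * |D| + 2 * K * r ^ 2) ^ 2 := pow_le_pow_left₀ (abs_nonneg _) h2 2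
      _ = r ^ 2 * |D| ^ 2 + (4 * |D| * K + 4 * K ^ 2 * r) * r ^ 3 := by ring
      _ ≤ r ^ 2 * D ^ 2 + (4 * L * K + 4 * K ^ 2) * r ^ 3 := by
        have : 4 * K ^ 2 * r ≤ 4 * K ^ 2 := mul_le_of_le_one_right (by positivity) hr1
        rw [sq_abs]
        gcongr
  calc ∑ k, 𝔼 x, cubeDeriv k (fun x => u (cubeSum d n x)) x ^ 2
      ≤ ∑ k : Fin d × Fin n, 𝔼 x : Fin d × Fin n → ℤˣ,
        (r ^ 2 * fderiv ℝ u (cubeSum d n x) (EuclideanSpace.single k.1 1) ^ 2 +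
          (4 * L * K + 4 * K ^ 2) * r ^ 3) :=
        Finset.sum_le_sum fun k _ => Finset.expect_le_expect fun x _ => key k.1 k.2 x
    _ = 𝔼 x : Fin d × Fin n → ℤˣ, ((n * r ^ 2) * ‖gradient u (cubeSum d n x)‖ ^ 2 +
          d * (4 * L * K + 4 * K ^ 2) * ((n * r ^ 2) * r)) := by
        rw [← Finset.expect_sum_comm]
        refine Finset.expect_congr rfl fun x _ => ?_
        rw [Finset.sum_add_distrib, Fintype.sum_prod_type]
        simp only [Finset.sum_const, Finset.card_univ, Fintype.card_fin, Fintype.card_prod,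
          nsmul_eq_mul, ← sum_fderiv_single_sq, ← Finset.mul_sum]
        push_cast
        ring
    _ = _ := by
        rw [hr2, Finset.expect_add_distrib, Fintype.expect_const]
        simp

/-- By symmetry, `u (cubeSum d n x)` has the same correlation with each of the `n` signs that make
up the `j`-th coordinate, so the first Walsh level of `u ∘ cubeSum d n` is the squared norm of the
mean of `u y • y`. -/
lemma sum_expect_comp_cubeSum_mul (u : EuclideanSpace ℝ (Fin d) → ℝ) {n : ℕ} (hn : 0 < n) :
    ∑ k, (𝔼 x, u (cubeSum d n x) * ((x k : ℤ) : ℝ)) ^ 2 =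
      ∑ j, (𝔼 x, u (cubeSum d n x) * cubeSum d n x j) ^ 2 := by
  set w : Fin d × Fin n → ℝ := fun k => 𝔼 x, u (cubeSum d n x) * ((x k : ℤ) : ℝ) with hw
  have hnpos : (0 : ℝ) < n := Nat.cast_pos.2 hn
  have hsymm : ∀ j i i', w (j, i) = w (j, i') := by
    intro j i i'
    have hS : ∀ x : Fin d × Fin n → ℤˣ,
        cubeSum d n (fun k => x (k.1, Equiv.swap i i' k.2)) = cubeSum d n x := by
      intro x
      ext j'
      simp only [cubeSum]
      congr 1
      exact Equiv.sum_comp (Equiv.swap i i') fun i => ((x (j', i) : ℤ) : ℝ)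
    let e : (Fin d × Fin n → ℤˣ) ≃ (Fin d × Fin n → ℤˣ) :=
      Equiv.arrowCongr (Equiv.prodCongr (Equiv.refl _) (Equiv.swap i i')) (Equiv.refl _)
    refine Fintype.expect_equiv e _ _ fun x => ?_
    have : e x = fun k => x (k.1, Equiv.swap i i' k.2) := by
      funext k; rfl
    rw [this, hS]
    simp
  have hsum : ∀ j, 𝔼 x, u (cubeSum d n x) * cubeSum d n x j = (√n)⁻¹ * ∑ i, w (j, i) := by
    intro j
    rw [hw, ← Finset.expect_sum_comm, Finset.mul_expect]
    refine Finset.expect_congr rfl fun x _ => ?_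
    simp only [cubeSum]
    rw [← Finset.mul_sum]
    ring
  rw [Fintype.sum_prod_type]
  refine Finset.sum_congr rfl fun j _ => ?_
  rw [hsum]
  have hc : ∀ i, w (j, i) = w (j, ⟨0, hn⟩) := fun i => hsymm _ _ _
  change ∑ i, w (j, i) ^ 2 = _
  simp_rw [hc]
  simp only [Finset.sum_const, Finset.card_univ, Fintype.card_fin, nsmul_eq_mul]
  rw [mul_pow, inv_pow, Real.sq_sqrt hnpos.le]
  field_simp

/-- The improved Beckner inequality for smooth compactly supported functions, with the contribution
of the first Hermite level kept as an error term. -/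
theorem gaussian_beckner_of_contDiff {p : ℝ} (hp1 : 1 ≤ p) (hp2 : p ≤ 2)
    {u : EuclideanSpace ℝ (Fin d) → ℝ} (hu : ContDiff ℝ ∞ u) (hsupp : HasCompactSupport u) :
    ∫ x, u x ^ 2 ∂(normalizedGaussian d) -
        ((∫ x, |u x| ^ p ∂(normalizedGaussian d)) ^ p⁻¹) ^ 2 ≤
      p * (2 - p) / 2 * ∫ x, ‖gradient u x‖ ^ 2 ∂(normalizedGaussian d) +
        (2 - p) ^ 2 / 2 * ∑ j, (∫ x, u x * x j ∂(normalizedGaussian d)) ^ 2 := by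
  have hp0 : 0 < p := by linarith
  have hgrad : Continuous (gradient u) :=
    (InnerProductSpace.toDual ℝ _).symm.continuous.comp (hu.continuous_fderiv (by simp))
  -- The hypothesis on `h` makes it vanish off the support of `u`, hence bounded.
  have hbd : ∀ h : EuclideanSpace ℝ (Fin d) → ℝ, Continuous h →
      (∀ x, u x = 0 → fderiv ℝ u x = 0 → h x = 0) →
      Tendsto (fun n : ℕ => 𝔼 x, h (cubeSum d n x)) atTop
        (𝓝 (∫ x, h x ∂(normalizedGaussian d))) := by
    intro h hc h0
    refine tendsto_expect_cubeSum d hc ?_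
    have hs : HasCompactSupport h := by
      refine HasCompactSupport.intro hsupp fun x hx => h0 x (image_eq_zero_of_notMem_tsupport hx) ?_
      exact image_eq_zero_of_notMem_tsupport fun hx' => hx (tsupport_fderiv_subset ℝ hx')
    exact hs.exists_bound_of_continuous hc
  obtain ⟨C, hC⟩ := sum_expect_cubeDeriv_comp_cubeSum_le hu hsupp
  have t1 := hbd (fun x => u x ^ 2) (by have := hu.continuous; fun_prop) (by simp +contextual)
  have t2 := hbd (fun x => |u x| ^ p)
    (hu.continuous.abs.rpow_const fun _ => Or.inr hp0.le)
    (by intro x hx _; simp [hx, Real.zero_rpow hp0.ne'])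
  have t3 := hbd (fun x => ‖gradient u x‖ ^ 2) (by fun_prop)
    (by intro x _ hx; simp [gradient, hx])
  have t4 : ∀ j, _ := fun j : Fin d => hbd (fun x => u x * x j)
    (by have := hu.continuous; fun_prop) (by simp +contextual)
  have t5 : Tendsto (fun n : ℕ => C * (√(n : ℝ))⁻¹) atTop (𝓝 0) := by
    rw [← mul_zero C]
    exact (tendsto_inv_atTop_zero.comp (Real.tendsto_sqrt_atTop.comp
      tendsto_natCast_atTop_atTop)).const_mul C
  have lhs := t1.sub ((t2.rpow_const (p := p⁻¹) (Or.inr (inv_nonneg.2 hp0.le))).pow 2)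
  have rhs := ((t3.add t5).const_mul (p * (2 - p) / 2)).add
    ((tendsto_finsetSum Finset.univ fun j _ => (t4 j).pow 2).const_mul ((2 - p) ^ 2 / 2))
  rw [add_zero] at rhs
  refine le_of_tendsto_of_tendsto lhs rhs ?_
  filter_upwards [eventually_gt_atTop 0] with n hn
  refine (cube_beckner hp1 hp2 fun x => u (cubeSum d n x)).trans ?_
  rw [sum_expect_comp_cubeSum_mul u hn]
  have := mul_le_mul_of_nonneg_left (hC n hn)
    (show 0 ≤ p * (2 - p) / 2 from div_nonneg (mul_nonneg hp0.le (by linarith)) zero_le_two)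
  linarith

end SmoothBeckner

/-! ### Mollification -/

section Mollification

lemma eLpNorm_two_rpow_two {α F : Type*} [MeasurableSpace α] [NormedAddCommGroup F]
    (f : α → F) (μ : Measure α) : eLpNorm f 2 μ ^ (2 : ℝ) = ∫⁻ x, ‖f x‖ₑ ^ (2 : ℝ) ∂μ :=
  eLpNorm_nnreal_pow_eq_lintegral (p := 2) two_ne_zero

variable {d : ℕ} {F : Type*} [NormedAddCommGroup F]

/-- Translations act continuously on `L^2`. -/
lemma tendsto_eLpNorm_translate_sub {H : EuclideanSpace ℝ (Fin d) → F}
    (hH : MemLp H 2 volume) :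
    Tendsto (fun t => eLpNorm (fun x => H (x - t) - H x) 2 volume) (𝓝 0) (𝓝 0) := by
  let G : C(EuclideanSpace ℝ (Fin d), C(EuclideanSpace ℝ (Fin d), EuclideanSpace ℝ (Fin d))) :=
    ContinuousMap.curry ⟨fun p => p.2 - p.1, by fun_prop⟩
  have hG : ∀ t, MeasurePreserving (G t) volume volume := fun t => measurePreserving_sub_right _ t
  have hc := Tendsto.compMeasurePreservingLp (E := F) (p := 2) (l := 𝓝 0)
    (tendsto_const_nhds (x := hH.toLp H)) (G.continuous.tendsto 0) hG (hG 0) (by simp)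
  rw [tendsto_iff_edist_tendsto_0] at hc
  refine hc.congr fun t => ?_
  rw [Lp.toLp_compMeasurePreserving, Lp.toLp_compMeasurePreserving, Lp.edist_toLp_toLp]
  congr 1
  funext x
  simp [G]

variable [NormedSpace ℝ F] [CompleteSpace F]

open scoped Convolution in
/-- A mollification is an average of translates, so by Jensen's inequality and Tonelli's theorem it
is as close to the function in `L^2` as the translates are. -/
lemma eLpNorm_normed_convolution_sub_le (φ : ContDiffBump (0 : EuclideanSpace ℝ (Fin d)))
    {H : EuclideanSpace ℝ (Fin d) → F} (hm : StronglyMeasurable H) (hH : MemLp H 2 volume)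
    {ε : ℝ≥0∞} (hε : ∀ t ∈ Metric.ball (0 : EuclideanSpace ℝ (Fin d)) φ.rOut,
      eLpNorm (fun x => H (x - t) - H x) 2 volume ≤ ε) :
    eLpNorm (fun x => (φ.normed volume ⋆[ContinuousLinearMap.lsmul ℝ ℝ, volume] H) x - H x) 2
      volume ≤ ε := by
  set ψ := φ.normed volume with hψ
  have hψm : Measurable fun t => ENNReal.ofReal (ψ t) :=
    φ.continuous_normed.measurable.ennreal_ofReal
  set ν := (volume : Measure (EuclideanSpace ℝ (Fin d))).withDensity
    fun t => ENNReal.ofReal (ψ t) with hν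
  have hν1 : ∫⁻ t, ENNReal.ofReal (ψ t) = 1 := by
    rw [← ofReal_integral_eq_lintegral_ofReal φ.integrable_normed
      (ae_of_all _ φ.nonneg_normed), φ.integral_normed, ENNReal.ofReal_one]
  have : IsProbabilityMeasure ν := ⟨by
    rw [hν, withDensity_apply _ MeasurableSet.univ, Measure.restrict_univ, hν1]⟩
  have hloc : LocallyIntegrable H volume := hH.locallyIntegrable (by norm_num)
  have hmeas : Measurable fun z : EuclideanSpace ℝ (Fin d) × EuclideanSpace ℝ (Fin d) =>
      ‖H (z.1 - z.2) - H z.1‖ₑ ^ (2 : ℝ) :=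
    (((hm.comp_measurable (measurable_fst.sub measurable_snd)).sub
      (hm.comp_measurable measurable_fst)).enorm).pow_const _
  have hpt : ∀ x, ‖(ψ ⋆[ContinuousLinearMap.lsmul ℝ ℝ, volume] H) x - H x‖ₑ ^ (2 : ℝ) ≤
      ∫⁻ t, ‖H (x - t) - H x‖ₑ ^ (2 : ℝ) ∂ν := by
    intro x
    have hex : Integrable (fun t => ψ t • H (x - t)) volume :=
      φ.hasCompactSupport_normed.convolutionExists_left (ContinuousLinearMap.lsmul ℝ ℝ)
        φ.continuous_normed hloc x
    have e : (ψ ⋆[ContinuousLinearMap.lsmul ℝ ℝ, volume] H) x - H x =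
        ∫ t, (H (x - t) - H x) ∂ν := by
      rw [hν, integral_withDensity_eq_integral_toReal_smul hψm (by simp)]
      have : ∀ t, (ENNReal.ofReal (ψ t)).toReal • (H (x - t) - H x) =
          ψ t • H (x - t) - ψ t • H x := fun t => by
        rw [ENNReal.toReal_ofReal (φ.nonneg_normed t), smul_sub]
      simp_rw [this]
      rw [integral_sub hex (φ.integrable_normed.smul_const _), φ.integral_normed_smul]
      rfl
    have hx : AEStronglyMeasurable (fun t => H (x - t) - H x) ν :=
      ((hm.comp_measurable (measurable_const.sub measurable_id)).sub
        stronglyMeasurable_const).aestronglyMeasurable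
    rw [e, ← eLpNorm_two_rpow_two]
    refine ENNReal.rpow_le_rpow ?_ zero_le_two
    refine (enorm_integral_le_lintegral_enorm _).trans ?_
    rw [← eLpNorm_one_eq_lintegral_enorm]
    exact eLpNorm_le_eLpNorm_of_exponent_le (by norm_num) hx
  rw [← ENNReal.rpow_le_rpow_iff (z := 2) two_pos, eLpNorm_two_rpow_two]
  calc ∫⁻ x, ‖(ψ ⋆[ContinuousLinearMap.lsmul ℝ ℝ, volume] H) x - H x‖ₑ ^ (2 : ℝ)
      ≤ ∫⁻ x, ∫⁻ t, ‖H (x - t) - H x‖ₑ ^ (2 : ℝ) ∂ν := lintegral_mono hpt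
    _ = ∫⁻ t, (∫⁻ x, ‖H (x - t) - H x‖ₑ ^ (2 : ℝ)) ∂ν :=
        lintegral_lintegral_swap hmeas.aemeasurable
    _ = ∫⁻ t, ENNReal.ofReal (ψ t) * ∫⁻ x, ‖H (x - t) - H x‖ₑ ^ (2 : ℝ) := by
        rw [hν, lintegral_withDensity_eq_lintegral_mul _ hψm
          (hmeas.lintegral_prod_left')]
        rfl
    _ ≤ ∫⁻ t, ENNReal.ofReal (ψ t) * ε ^ (2 : ℝ) := by
        refine lintegral_mono fun t => ?_
        by_cases ht : t ∈ Metric.ball (0 : EuclideanSpace ℝ (Fin d)) φ.rOut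
        · rw [← eLpNorm_two_rpow_two]
          exact mul_le_mul_right (ENNReal.rpow_le_rpow (hε t ht) zero_le_two) _
        · rw [← φ.support_normed_eq (μ := volume), Function.notMem_support] at ht
          simp [hψ, ht]
    _ = ε ^ (2 : ℝ) := by
        rw [lintegral_mul_const _ hψm, hν1, one_mul]

open scoped Convolution in
/-- Mollifications of an `L^2` function converge to it in `L^2`. -/
lemma exists_eLpNorm_normed_convolution_sub_le {H : EuclideanSpace ℝ (Fin d) → F}
    (hH : MemLp H 2 volume) {ε : ℝ≥0∞} (hε : ε ≠ 0) :
    ∃ δ > 0, ∀ φ : ContDiffBump (0 : EuclideanSpace ℝ (Fin d)), φ.rOut ≤ δ →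
      eLpNorm (fun x => (φ.normed volume ⋆[ContinuousLinearMap.lsmul ℝ ℝ, volume] H) x - H x) 2
        volume ≤ ε := by
  obtain ⟨H', hm, hHH'⟩ := hH.1
  have hH' : MemLp H' 2 volume := hH.ae_eq hHH'
  have hev := (tendsto_eLpNorm_translate_sub hH').eventually_le_const (pos_iff_ne_zero.2 hε)
  obtain ⟨δ, hδ, hball⟩ := Metric.eventually_nhds_iff_ball.1 hev
  refine ⟨δ, hδ, fun φ hφ => ?_⟩
  have h := eLpNorm_normed_convolution_sub_le φ hm hH'
    fun t ht => hball t (Metric.ball_subset_ball hφ ht)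
  refine le_trans (le_of_eq (eLpNorm_congr_ae ?_)) h
  filter_upwards [hHH'] with x hx
  rw [hx]
  congr 1
  refine integral_congr_ae ?_
  filter_upwards [(quasiMeasurePreserving_sub_left volume x).ae_eq_comp hHH'] with t ht
  simp only [Function.comp_apply] at ht
  simp only [ht]

end Mollification

section WeakGradient

variable {d : ℕ}

open scoped Convolution in
/-- The gradient of a mollification is the mollification of the weak gradient: use the translated
and reflected mollifier `t ↦ ψ (x - t)` as a test function. -/
lemma HasWeakGradient.gradient_convolution {f : EuclideanSpace ℝ (Fin d) → ℝ}
    {g : EuclideanSpace ℝ (Fin d) → EuclideanSpace ℝ (Fin d)} (h : HasWeakGradient f g)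
    {ψ : EuclideanSpace ℝ (Fin d) → ℝ} (hψ : ContDiff ℝ ∞ ψ) (hψs : HasCompactSupport ψ) :
    gradient (ψ ⋆[ContinuousLinearMap.lsmul ℝ ℝ, volume] f) =
      ψ ⋆[ContinuousLinearMap.lsmul ℝ ℝ, volume] g := by
  funext x
  refine ext_inner_right ℝ fun v => ?_
  rw [inner_gradient_left]
  have hd := hψs.hasFDerivAt_convolution_left (ContinuousLinearMap.lsmul ℝ ℝ) (μ := volume)
    (hψ.of_le (by simp)) h.locallyIntegrable x
  have hψ' : Differentiable ℝ ψ := hψ.differentiable (by simp)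
  have hex : Integrable (fun t => (ContinuousLinearMap.lsmul ℝ ℝ).precompL
      (EuclideanSpace ℝ (Fin d)) (fderiv ℝ ψ t) (f (x - t))) volume :=
    (hψs.fderiv ℝ).convolutionExists_left _ (hψ.continuous_fderiv (by simp)) h.locallyIntegrable x
  have hexg : Integrable (fun t => ψ t • g (x - t)) volume :=
    hψs.convolutionExists_left (ContinuousLinearMap.lsmul ℝ ℝ) hψ.continuous
      h.locallyIntegrable_grad x
  rw [hd.fderiv, convolution_def, ContinuousLinearMap.integral_apply hex]
  have e1 : ∫ t, ((ContinuousLinearMap.lsmul ℝ ℝ).precompL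
      (EuclideanSpace ℝ (Fin d)) (fderiv ℝ ψ t) (f (x - t))) v =
      ∫ t, f t * fderiv ℝ ψ (x - t) v := by
    rw [← integral_sub_left_eq_self _ volume x]
    refine integral_congr_ae (ae_of_all _ fun t => ?_)
    simp [ContinuousLinearMap.precompL_apply, mul_comm]
  have hφ : ContDiff ℝ ∞ fun t => ψ (x - t) := hψ.comp (contDiff_const.sub contDiff_id)
  have hφs : HasCompactSupport fun t => ψ (x - t) :=
    hψs.comp_homeomorph (Homeomorph.subLeft x)
  have hφd : ∀ t, fderiv ℝ (fun t => ψ (x - t)) t v = - fderiv ℝ ψ (x - t) v := by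
    intro t
    have : HasFDerivAt (fun t => ψ (x - t)) _ t :=
      (hψ' (x - t)).hasFDerivAt.comp t ((hasFDerivAt_id t).const_sub x)
    rw [this.fderiv]
    simp
  have hw := h.integral_eq _ hφ hφs v
  simp_rw [hφd, mul_neg, integral_neg, neg_inj] at hw
  rw [e1, hw, convolution_def, real_inner_comm]
  simp only [ContinuousLinearMap.lsmul_apply]
  rw [← integral_inner hexg, ← integral_sub_left_eq_self _ volume x]
  refine integral_congr_ae (ae_of_all _ fun t => ?_)
  simp [inner_smul_right, real_inner_comm, mul_comm]

/-- A compactly supported function with a weak gradient in `L^2` is approximated in the Sobolev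
norm by smooth compactly supported functions. -/
lemma HasWeakGradient.exists_contDiff_approx {f : EuclideanSpace ℝ (Fin d) → ℝ}
    {g : EuclideanSpace ℝ (Fin d) → EuclideanSpace ℝ (Fin d)} (h : HasWeakGradient f g)
    (hs : HasCompactSupport f) (hf : MemLp f 2 volume) (hg : MemLp g 2 volume)
    {ε : ℝ≥0∞} (hε : ε ≠ 0) :
    ∃ u : EuclideanSpace ℝ (Fin d) → ℝ, ContDiff ℝ ∞ u ∧ HasCompactSupport u ∧
      eLpNorm (fun x => u x - f x) 2 volume ≤ ε ∧
      eLpNorm (fun x => gradient u x - g x) 2 volume ≤ ε := by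
  obtain ⟨δ₁, h1, H1⟩ := exists_eLpNorm_normed_convolution_sub_le hf hε
  obtain ⟨δ₂, h2, H2⟩ := exists_eLpNorm_normed_convolution_sub_le hg hε
  have hδ : 0 < min δ₁ δ₂ := lt_min h1 h2
  let φ : ContDiffBump (0 : EuclideanSpace ℝ (Fin d)) :=
    ⟨min δ₁ δ₂ / 2, min δ₁ δ₂, by positivity, by linarith⟩
  refine ⟨_, φ.hasCompactSupport_normed.contDiff_convolution_left (n := ⊤)
    (ContinuousLinearMap.lsmul ℝ ℝ) φ.contDiff_normed h.locallyIntegrable,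
    φ.hasCompactSupport_normed.convolution _ hs, H1 φ (min_le_left _ _), ?_⟩
  rw [h.gradient_convolution φ.contDiff_normed φ.hasCompactSupport_normed]
  exact H2 φ (min_le_right _ _)

end WeakGradient

/-! ### Weak gradients and density of smooth functions -/

section Cutoff

variable {d : ℕ}

lemma normalizedGaussian_le_volume : normalizedGaussian d ≤ volume := by
  calc normalizedGaussian d ≤ volume.withDensity 1 := by
        rw [normalizedGaussian_eq]
        refine withDensity_mono (ae_of_all _ fun x => ?_)
        rw [Pi.one_apply, ENNReal.ofReal_le_one, gaussianDensity]
        refine mul_le_one₀ (Real.rpow_le_one_of_one_le_of_nonpos ?_ ?_) (Real.exp_pos _).le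
          (Real.exp_le_one_iff.2 ?_)
        · linarith [Real.pi_gt_three]
        · exact div_nonpos_of_nonpos_of_nonneg (neg_nonpos.2 (Nat.cast_nonneg d)) zero_le_two
        · exact div_nonpos_of_nonpos_of_nonneg (neg_nonpos.2 (sq_nonneg _)) zero_le_two
    _ = volume := withDensity_one

lemma ae_normalizedGaussian_of_ae_volume {P : EuclideanSpace ℝ (Fin d) → Prop}
    (h : ∀ᵐ x ∂volume, P x) : ∀ᵐ x ∂(normalizedGaussian d), P x :=
  (withDensity_absolutelyContinuous _ _).ae_le h

/-- For functions of compact support, Gaussian integrability implies Lebesgue integrability, as the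
Gaussian density is bounded below on compact sets. -/
lemma memLp_volume_of_hasCompactSupport {F : Type*} [NormedAddCommGroup F] {p : ℝ≥0∞}
    {h : EuclideanSpace ℝ (Fin d) → F} (hh : MemLp h p (normalizedGaussian d))
    (hs : HasCompactSupport h) : MemLp h p volume := by
  have hK : MeasurableSet (tsupport h) := (isClosed_tsupport h).measurableSet
  have hind : (tsupport h).indicator h = h :=
    Set.indicator_eq_self.2 (subset_tsupport h)
  rw [← hind, memLp_indicator_iff_restrict hK]
  have hcont : ContinuousOn (fun x => (gaussianDensity d x)⁻¹) (tsupport h) :=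
    (continuous_gaussianDensity.inv₀ fun x => (gaussianDensity_pos x).ne').continuousOn
  obtain ⟨C, hC⟩ := hs.isCompact.exists_bound_of_continuousOn hcont
  refine MemLp.of_measure_le_smul (c := ENNReal.ofReal C) (by simp) ?_ hh
  refine Measure.le_iff.2 fun A hA => ?_
  have hm : Measurable fun x => ENNReal.ofReal (gaussianDensity d x) :=
    continuous_gaussianDensity.measurable.ennreal_ofReal
  rw [Measure.restrict_apply hA, Measure.smul_apply, smul_eq_mul, normalizedGaussian_eq,
    withDensity_apply _ hA, ← lintegral_const_mul _ hm, ← setLIntegral_one]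
  refine (setLIntegral_mono' (hA.inter hK) fun x hx => ?_).trans
    (lintegral_mono_set Set.inter_subset_left)
  have h1 := (le_abs_self _).trans (hC x hx.2)
  have h2 := gaussianDensity_pos x
  rw [← ENNReal.ofReal_mul' h2.le, ENNReal.one_le_ofReal]
  calc (1 : ℝ) = (gaussianDensity d x)⁻¹ * gaussianDensity d x := (inv_mul_cancel₀ h2.ne').symm
    _ ≤ C * gaussianDensity d x := mul_le_mul_of_nonneg_right h1 h2.le

/-- Dominated convergence in `L^2`. -/
lemma tendsto_eLpNorm_two_of_dominated {α F : Type*} [MeasurableSpace α] {μ : Measure α}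
    [NormedAddCommGroup F] {h : ℕ → α → F} {B : α → ℝ} (hm : ∀ k, AEStronglyMeasurable (h k) μ)
    (hB : MemLp B 2 μ) (hle : ∀ k x, ‖h k x‖ ≤ B x)
    (hlim : ∀ x, Tendsto (fun k => h k x) atTop (𝓝 0)) :
    Tendsto (fun k => eLpNorm (h k) 2 μ) atTop (𝓝 0) := by
  have key : Tendsto (fun k => ∫⁻ x, ‖h k x‖ₑ ^ (2 : ℝ) ∂μ) atTop (𝓝 (∫⁻ _, 0 ∂μ)) := by
    refine tendsto_lintegral_of_dominated_convergence' (fun x => ‖B x‖ₑ ^ (2 : ℝ))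
      (fun k => (hm k).enorm.pow_const _) (fun k => ae_of_all _ fun x => ?_) ?_
      (ae_of_all _ fun x => ?_)
    · refine ENNReal.rpow_le_rpow ?_ zero_le_two
      rw [enorm_le_iff_norm_le]
      exact (hle k x).trans (le_abs_self _)
    · rw [← eLpNorm_two_rpow_two]
      exact ENNReal.rpow_ne_top_of_nonneg zero_le_two hB.eLpNorm_ne_top
    · have := (hlim x).enorm
      simpa using this.ennrpow_const (2 : ℝ)
  have hk : ∀ k, eLpNorm (h k) 2 μ = (∫⁻ x, ‖h k x‖ₑ ^ (2 : ℝ) ∂μ) ^ (2 : ℝ)⁻¹ := fun k => by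
    rw [← eLpNorm_two_rpow_two, ← ENNReal.rpow_mul, mul_inv_cancel₀ two_ne_zero, ENNReal.rpow_one]
  simp_rw [hk]
  simpa using key.ennrpow_const (2 : ℝ)⁻¹

/-- The product rule for the weak gradient. -/
lemma HasWeakGradient.smul_contDiff {f : EuclideanSpace ℝ (Fin d) → ℝ}
    {g : EuclideanSpace ℝ (Fin d) → EuclideanSpace ℝ (Fin d)} (h : HasWeakGradient f g)
    {χ : EuclideanSpace ℝ (Fin d) → ℝ} (hχ : ContDiff ℝ ∞ χ) (hχs : HasCompactSupport χ) :
    HasWeakGradient (fun x => χ x * f x) (fun x => χ x • g x + f x • gradient χ x) := by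
  have hgc : Continuous (gradient χ) :=
    (InnerProductSpace.toDual ℝ _).symm.continuous.comp (hχ.continuous_fderiv (by simp))
  have hgs : HasCompactSupport (gradient χ) :=
    (hχs.fderiv ℝ).comp_left (g := (InnerProductSpace.toDual ℝ _).symm) (map_zero _)
  have hχd : Differentiable ℝ χ := hχ.differentiable (by simp)
  have i1 : Integrable (fun x => χ x * f x) volume :=
    h.locallyIntegrable.integrable_smul_left_of_hasCompactSupport hχ.continuous hχs
  have i2 : Integrable (fun x => χ x • g x) volume :=
    h.locallyIntegrable_grad.integrable_smul_left_of_hasCompactSupport hχ.continuous hχs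
  have i3 : Integrable (fun x => f x • gradient χ x) volume :=
    h.locallyIntegrable.integrable_smul_right_of_hasCompactSupport hgc hgs
  refine ⟨i1.locallyIntegrable, (i2.add i3).locallyIntegrable, fun φ hφ hφs v => ?_⟩
  have hφd : Differentiable ℝ φ := hφ.differentiable (by simp)
  have hw := h.integral_eq (fun x => χ x * φ x) (hχ.mul hφ) (hχs.mul_right) v
  have hderiv : ∀ x, fderiv ℝ (fun x => χ x * φ x) x v =
      χ x * fderiv ℝ φ x v + φ x * inner ℝ (gradient χ x) v := by
    intro x
    have : HasFDerivAt (fun x => χ x * φ x) _ x := (hχd x).hasFDerivAt.mul (hφd x).hasFDerivAt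
    rw [this.fderiv, inner_gradient_left]
    simp
  have j1 : Integrable (fun x => f x * (χ x * fderiv ℝ φ x v)) volume :=
    h.locallyIntegrable.integrable_smul_right_of_hasCompactSupport
      (hχ.continuous.mul ((hφ.continuous_fderiv (by simp)).clm_apply continuous_const))
      hχs.mul_right
  have j2 : Integrable (fun x => f x * (φ x * inner ℝ (gradient χ x) v)) volume :=
    h.locallyIntegrable.integrable_smul_right_of_hasCompactSupport
      (hφ.continuous.mul (hgc.inner (𝕜 := ℝ) continuous_const)) hφs.mul_right
  have j3 : Integrable (fun x => inner ℝ (g x) v * (χ x * φ x)) volume := by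
    have := (h.locallyIntegrable_grad.integrable_smul_left_of_hasCompactSupport
      (g := fun x => χ x * φ x) (hχ.continuous.mul hφ.continuous) hχs.mul_right).inner_const (𝕜 := ℝ) v
    refine this.congr (ae_of_all _ fun x => ?_)
    simp [inner_smul_left, mul_comm]
  simp_rw [hderiv, mul_add] at hw
  rw [integral_add j1 j2] at hw
  calc ∫ x, χ x * f x * fderiv ℝ φ x v = ∫ x, f x * (χ x * fderiv ℝ φ x v) := by
        refine integral_congr_ae (ae_of_all _ fun x => ?_)
        simp only; ring
    _ = -((∫ x, inner ℝ (g x) v * (χ x * φ x)) + ∫ x, f x * (φ x * inner ℝ (gradient χ x) v)) := by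
        linarith
    _ = - ∫ x, inner ℝ (χ x • g x + f x • gradient χ x) v * φ x := by
        rw [← integral_add j3 j2]
        congr 1
        refine integral_congr_ae (ae_of_all _ fun x => ?_)
        simp only [inner_add_left, real_inner_smul_left]; ring

/-- Smooth cutoffs `χ k`, equal to `1` on larger and larger balls, with uniformly small gradient:
dilations of a fixed bump function. -/
lemma exists_cutoff_seq (d : ℕ) :
    ∃ (χ : ℕ → EuclideanSpace ℝ (Fin d) → ℝ) (C : ℝ), (∀ k, ContDiff ℝ ∞ (χ k)) ∧
      (∀ k, HasCompactSupport (χ k)) ∧ (∀ k x, 0 ≤ χ k x) ∧ (∀ k x, χ k x ≤ 1) ∧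
      (∀ x, Tendsto (fun k => χ k x) atTop (𝓝 1)) ∧ (∀ k x, ‖gradient (χ k) x‖ ≤ C) ∧
      ∀ x, Tendsto (fun k => gradient (χ k) x) atTop (𝓝 0) := by
  obtain ⟨b, hb⟩ : ∃ b : ContDiffBump (0 : EuclideanSpace ℝ (Fin d)), ContDiff ℝ ∞ b :=
    ⟨⟨1, 2, one_pos, one_lt_two⟩, ContDiffBump.contDiff _⟩
  obtain ⟨C, hC⟩ := (b.hasCompactSupport.fderiv ℝ).exists_bound_of_continuous
    (hb.continuous_fderiv (by simp))
  have hC0 : 0 ≤ C := (norm_nonneg _).trans (hC 0)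
  obtain ⟨r, hr0, hr1, hrlim⟩ : ∃ r : ℕ → ℝ, (∀ k, 0 < r k) ∧ (∀ k, r k ≤ 1) ∧
      Tendsto r atTop (𝓝 0) :=
    ⟨fun k => 1 / ((k : ℝ) + 1), fun k => Nat.one_div_pos_of_nat,
      fun k => (div_le_one (by positivity)).2 (by simp), tendsto_one_div_add_atTop_nhds_zero_nat⟩
  have hχ : ∀ k, ContDiff ℝ ∞ fun x => b (r k • x) := fun k => hb.comp (contDiff_const_smul (r k))
  have hgrad : ∀ k x, ‖gradient (fun x => b (r k • x)) x‖ ≤ C * r k := by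
    intro k x
    have hd : HasFDerivAt (fun x => b (r k • x)) (fderiv ℝ b (r k • x) ∘L
        (r k • ContinuousLinearMap.id ℝ (EuclideanSpace ℝ (Fin d)))) x :=
      (hb.differentiable (by simp) _).hasFDerivAt.comp x ((hasFDerivAt_id x).const_smul (r k))
    rw [gradient, LinearIsometryEquiv.norm_map, hd.fderiv, ContinuousLinearMap.comp_smul,
      norm_smul, ContinuousLinearMap.comp_id, Real.norm_eq_abs, abs_of_pos (hr0 k), mul_comm]
    exact mul_le_mul_of_nonneg_right (hC _) (hr0 k).le
  refine ⟨fun k x => b (r k • x), C, hχ,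
    fun k => b.hasCompactSupport.comp_homeomorph (Homeomorph.smulOfNeZero (r k) (hr0 k).ne'),
    fun k x => b.nonneg, fun k x => b.le_one, fun x => ?_,
    fun k x => (hgrad k x).trans (mul_le_of_le_one_right hC0 (hr1 k)),
    fun x => squeeze_zero_norm (fun k => hgrad k x) (by simpa using hrlim.const_mul C)⟩
  have h1 : Tendsto (fun k => r k • x) atTop (𝓝 0) := by
    simpa using hrlim.smul_const x
  have h2 := (b.continuous.tendsto 0).comp h1
  rwa [b.one_of_mem_closedBall (Metric.mem_closedBall_self b.rIn_pos.le)] at h2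

/-- Functions with compact support are dense in the Gaussian Sobolev space. -/
lemma HasWeakGradient.exists_hasCompactSupport_approx {f : EuclideanSpace ℝ (Fin d) → ℝ}
    {g : EuclideanSpace ℝ (Fin d) → EuclideanSpace ℝ (Fin d)} (h : HasWeakGradient f g)
    (hf : MemLp f 2 (normalizedGaussian d)) (hg : MemLp g 2 (normalizedGaussian d))
    {ε : ℝ≥0∞} (hε : 0 < ε) :
    ∃ f' g', HasWeakGradient f' g' ∧ HasCompactSupport f' ∧ MemLp f' 2 (volume : Measure _) ∧
      MemLp g' 2 (volume : Measure _) ∧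
      eLpNorm (fun x => f' x - f x) 2 (normalizedGaussian d) ≤ ε ∧
      eLpNorm (fun x => g' x - g x) 2 (normalizedGaussian d) ≤ ε := by
  obtain ⟨χ, C, hχ, hχs, hχ0, hχ1, hχlim, hgrad, hgradlim⟩ := exists_cutoff_seq d
  have hgc : ∀ k, Continuous (gradient (χ k)) := fun k =>
    (InnerProductSpace.toDual ℝ _).symm.continuous.comp ((hχ k).continuous_fderiv (by simp))
  have hsub : ∀ k x, ‖χ k x - 1‖ ≤ 1 := fun k x => by
    rw [Real.norm_eq_abs, abs_le]
    constructor <;> linarith [hχ0 k x, hχ1 k x]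
  have hsublim : ∀ x, Tendsto (fun k => χ k x - 1) atTop (𝓝 0) := fun x => by
    simpa using (hχlim x).sub_const 1
  have e1 : ∀ k x, χ k x * f x - f x = (χ k x - 1) * f x := fun k x => by ring
  have e2 : ∀ k x, χ k x • g x + f x • gradient (χ k) x - g x =
      (χ k x - 1) • g x + f x • gradient (χ k) x := fun k x => by rw [sub_smul, one_smul]; abel
  have m1 : ∀ k, AEStronglyMeasurable (fun x => χ k x * f x - f x) (normalizedGaussian d) :=
    fun k => ((hχ k).continuous.aestronglyMeasurable.mul hf.1).sub hf.1
  have m2 : ∀ k, AEStronglyMeasurable (fun x => χ k x • g x + f x • gradient (χ k) x - g x)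
      (normalizedGaussian d) := fun k =>
    (((hχ k).continuous.aestronglyMeasurable.smul hg.1).add
      (hf.1.smul (hgc k).aestronglyMeasurable)).sub hg.1
  have b1 : ∀ k x, ‖χ k x * f x - f x‖ ≤ ‖f x‖ := fun k x => by
    rw [e1, norm_mul]
    exact mul_le_of_le_one_left (norm_nonneg _) (hsub k x)
  have b2 : ∀ k x, ‖χ k x • g x + f x • gradient (χ k) x - g x‖ ≤ ‖g x‖ + C * ‖f x‖ := fun k x => by
    rw [e2]
    refine (norm_add_le _ _).trans (add_le_add ?_ ?_)
    · rw [norm_smul]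
      exact mul_le_of_le_one_left (norm_nonneg _) (hsub k x)
    · rw [norm_smul, mul_comm]
      exact mul_le_mul_of_nonneg_right (hgrad k x) (norm_nonneg _)
  have hB2 : MemLp (fun x => ‖g x‖ + C * ‖f x‖) 2 (normalizedGaussian d) :=
    hg.norm.add (hf.norm.const_mul C)
  have l1 := tendsto_eLpNorm_two_of_dominated m1 hf.norm b1 fun x => by
    simp_rw [e1]
    simpa using (hsublim x).mul_const (f x)
  have l2 := tendsto_eLpNorm_two_of_dominated m2 hB2 b2 fun x => by
    simp_rw [e2]
    simpa using ((hsublim x).smul_const (g x)).add ((hgradlim x).const_smul (f x))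
  obtain ⟨k, hk1, hk2⟩ := ((l1.eventually_le_const hε).and (l2.eventually_le_const hε)).exists
  have hsf : HasCompactSupport fun x => χ k x * f x := (hχs k).mul_right
  have hsg : HasCompactSupport fun x => χ k x • g x + f x • gradient (χ k) x := by
    refine HasCompactSupport.intro (hχs k) fun x hx => ?_
    have h1 : fderiv ℝ (χ k) x = 0 :=
      image_eq_zero_of_notMem_tsupport fun hx' => hx (tsupport_fderiv_subset ℝ hx')
    simp [gradient, h1, image_eq_zero_of_notMem_tsupport hx]
  have mf : MemLp (fun x => χ k x * f x) 2 (normalizedGaussian d) := by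
    have : MemLp (fun x => χ k x * f x - f x) 2 (normalizedGaussian d) :=
      hf.norm.mono' (m1 k) (ae_of_all _ (b1 k))
    refine (this.add hf).ae_eq (ae_of_all _ fun x => ?_)
    simp
  have mg : MemLp (fun x => χ k x • g x + f x • gradient (χ k) x) 2 (normalizedGaussian d) := by
    have : MemLp (fun x => χ k x • g x + f x • gradient (χ k) x - g x) 2 (normalizedGaussian d) :=
      hB2.mono' (m2 k) (ae_of_all _ (b2 k))
    refine (this.add hg).ae_eq (ae_of_all _ fun x => ?_)
    simp
  exact ⟨_, _, h.smul_contDiff (hχ k) (hχs k), hsf, memLp_volume_of_hasCompactSupport mf hsf,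
    memLp_volume_of_hasCompactSupport mg hsg, hk1, hk2⟩

/-- Smooth compactly supported functions are dense in the Gaussian Sobolev space. -/
theorem HasWeakGradient.exists_contDiff_approx_gaussian {f : EuclideanSpace ℝ (Fin d) → ℝ}
    {g : EuclideanSpace ℝ (Fin d) → EuclideanSpace ℝ (Fin d)} (h : HasWeakGradient f g)
    (hf : MemLp f 2 (normalizedGaussian d)) (hg : MemLp g 2 (normalizedGaussian d))
    {ε : ℝ≥0∞} (hε : 0 < ε) :
    ∃ u : EuclideanSpace ℝ (Fin d) → ℝ, ContDiff ℝ ∞ u ∧ HasCompactSupport u ∧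
      eLpNorm (fun x => u x - f x) 2 (normalizedGaussian d) ≤ ε ∧
      eLpNorm (fun x => gradient u x - g x) 2 (normalizedGaussian d) ≤ ε := by
  have hε2 : 0 < ε / 2 := ENNReal.half_pos hε.ne'
  obtain ⟨f', g', hw, hs, hf', hg', h1, h2⟩ := h.exists_hasCompactSupport_approx hf hg hε2
  obtain ⟨u, hu, hus, h3, h4⟩ := hw.exists_contDiff_approx hs hf' hg' hε2.ne'
  have hgc : Continuous (gradient u) :=
    (InnerProductSpace.toDual ℝ _).symm.continuous.comp (hu.continuous_fderiv (by simp))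
  have hle := normalizedGaussian_le_volume (d := d)
  refine ⟨u, hu, hus, ?_, ?_⟩
  · have e : (fun x => u x - f x) = (fun x => u x - f' x) + fun x => f' x - f x := by
      funext x; simp
    rw [e, ← ENNReal.add_halves ε]
    have hm := (hf'.1.mono_measure hle)
    exact (eLpNorm_add_le (hu.continuous.aestronglyMeasurable.sub hm) (hm.sub hf.1)
      (by norm_num)).trans (add_le_add ((eLpNorm_mono_measure _ hle).trans h3) h1)
  · have e : (fun x => gradient u x - g x) =
        (fun x => gradient u x - g' x) + fun x => g' x - g x := by
      funext x; simp
    rw [e, ← ENNReal.add_halves ε]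
    have hm := (hg'.1.mono_measure hle)
    exact (eLpNorm_add_le (hgc.aestronglyMeasurable.sub hm) (hm.sub hg.1)
      (by norm_num)).trans (add_le_add ((eLpNorm_mono_measure _ hle).trans h4) h2)

/-- The weak gradient is unique almost everywhere. -/
lemma HasWeakGradient.ae_eq {f : EuclideanSpace ℝ (Fin d) → ℝ}
    {g g' : EuclideanSpace ℝ (Fin d) → EuclideanSpace ℝ (Fin d)} (h : HasWeakGradient f g)
    (h' : HasWeakGradient f g') : g =ᵐ[volume] g' := by
  refine ae_eq_of_integral_contDiff_smul_eq h.locallyIntegrable_grad h'.locallyIntegrable_grad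
    fun φ hφ hφs => ?_
  refine ext_inner_left ℝ fun v => ?_
  have hi := fun {k : EuclideanSpace ℝ (Fin d) → EuclideanSpace ℝ (Fin d)}
    (hk : LocallyIntegrable k volume) =>
    hk.integrable_smul_left_of_hasCompactSupport hφ.continuous hφs
  rw [← integral_inner (hi h.locallyIntegrable_grad),
    ← integral_inner (hi h'.locallyIntegrable_grad)]
  have := (h.integral_eq φ hφ hφs v).symm.trans (h'.integral_eq φ hφ hφs v)
  rw [neg_inj] at this
  simpa [inner_smul_right, real_inner_comm, mul_comm] using this

end Cutoff

/-! ### The inequality on the Gaussian Sobolev space -/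

section Limit

variable {d : ℕ}

/-- The second moment of the Gaussian measure is finite; the bound `s ≤ exp s` with `s = ‖x‖² / 4`
reduces this to the integrability of `exp (-‖x‖² / 4)`. -/
lemma memLp_norm_normalizedGaussian :
    MemLp (fun x : EuclideanSpace ℝ (Fin d) => ‖x‖) 2 (normalizedGaussian d) := by
  rw [memLp_two_iff_integrable_sq continuous_norm.aestronglyMeasurable, normalizedGaussian_eq,
    integrable_withDensity_iff_integrable_smul'
      continuous_gaussianDensity.measurable.ennreal_ofReal (by simp)]
  have hint : Integrable fun x : EuclideanSpace ℝ (Fin d) => Real.exp (-(1 / 4) * ‖x‖ ^ 2) := by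
    have h := GaussianFourier.integral_rexp_neg_mul_sq_norm (V := EuclideanSpace ℝ (Fin d))
      (b := 1 / 4) (by norm_num)
    by_contra hn
    rw [integral_undef hn] at h
    exact (Real.rpow_pos_of_pos (by positivity) _).ne h
  refine (hint.const_mul ((2 * Real.pi) ^ (-(d : ℝ) / 2) * 4)).mono'
    (by have := continuous_gaussianDensity (d := d)
        simp only [ENNReal.toReal_ofReal (gaussianDensity_pos _).le]
        exact (by fun_prop : Continuous _).aestronglyMeasurable) (ae_of_all _ fun x => ?_)
  have hpi : (0 : ℝ) ≤ (2 * Real.pi) ^ (-(d : ℝ) / 2) := by positivity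
  have h1 : ‖x‖ ^ 2 / 4 ≤ Real.exp (‖x‖ ^ 2 / 4) := by
    linarith [Real.add_one_le_exp (‖x‖ ^ 2 / 4)]
  have h2 : Real.exp (-(‖x‖ ^ 2) / 2) * Real.exp (‖x‖ ^ 2 / 4) =
      Real.exp (-(1 / 4) * ‖x‖ ^ 2) := by
    rw [← Real.exp_add]; congr 1; ring
  rw [ENNReal.toReal_ofReal (gaussianDensity_pos x).le, Real.norm_eq_abs, smul_eq_mul,
    abs_of_nonneg (mul_nonneg (gaussianDensity_pos x).le (sq_nonneg _)), gaussianDensity, ← h2]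
  have := mul_le_mul_of_nonneg_left h1 (mul_nonneg hpi (Real.exp_pos (-(‖x‖ ^ 2) / 2)).le)
  linarith

lemma tendsto_lpNorm_of_tendsto_eLpNorm_sub {α F : Type*} [MeasurableSpace α] {μ : Measure α}
    [NormedAddCommGroup F] {p : ℝ≥0∞} (hp : 1 ≤ p) {u : ℕ → α → F} {f : α → F}
    (hu : ∀ n, MemLp (u n) p μ) (hf : MemLp f p μ)
    (hlim : Tendsto (fun n => eLpNorm (fun x => u n x - f x) p μ) atTop (𝓝 0)) :
    Tendsto (fun n => lpNorm (u n) p μ) atTop (𝓝 (lpNorm f p μ)) := by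
  have h0 : Tendsto (fun n => lpNorm (u n - f) p μ) atTop (𝓝 0) := by
    have := (ENNReal.tendsto_toReal ENNReal.zero_ne_top).comp hlim
    refine this.congr fun n => ?_
    rw [← toReal_eLpNorm ((hu n).sub hf).1]
    rfl
  rw [tendsto_iff_norm_sub_tendsto_zero]
  refine squeeze_zero (fun _ => norm_nonneg _) (fun n => ?_) h0
  rw [Real.norm_eq_abs, abs_le]
  constructor
  · linarith [lpNorm_le_lpNorm_add_lpNorm_sub (f := f) (hu n) hp]
  · linarith [lpNorm_le_lpNorm_add_lpNorm_sub' (f := u n) hf hp]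

lemma lpNorm_two_sq {α F : Type*} [MeasurableSpace α] {μ : Measure α} [NormedAddCommGroup F]
    {f : α → F} (hf : AEStronglyMeasurable f μ) : lpNorm f 2 μ ^ 2 = ∫ x, ‖f x‖ ^ 2 ∂μ := by
  rw [lpNorm_eq_integral_norm_rpow_toReal two_ne_zero (by simp) hf, ← Real.rpow_natCast,
    ← Real.rpow_mul (integral_nonneg fun x => by positivity)]
  simp

/-- The improved Beckner inequality on the Gaussian Sobolev space, for functions orthogonal to the
coordinate functions. -/
theorem gaussian_beckner {p : ℝ} (hp1 : 1 ≤ p) (hp2 : p ≤ 2)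
    {f : EuclideanSpace ℝ (Fin d) → ℝ} {g : EuclideanSpace ℝ (Fin d) → EuclideanSpace ℝ (Fin d)}
    (h : HasWeakGradient f g) (hf : MemLp f 2 (normalizedGaussian d))
    (hg : MemLp g 2 (normalizedGaussian d))
    (horth : ∀ j, ∫ x, f x * x j ∂(normalizedGaussian d) = 0) :
    lpNorm f 2 (normalizedGaussian d) ^ 2 -
        lpNorm f (ENNReal.ofReal p) (normalizedGaussian d) ^ 2 ≤
      p * (2 - p) / 2 * lpNorm g 2 (normalizedGaussian d) ^ 2 := by
  have hp0 : 0 < p := by linarith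
  have hq1 : 1 ≤ ENNReal.ofReal p := ENNReal.one_le_ofReal.2 hp1
  have hq2 : ENNReal.ofReal p ≤ 2 := by
    rw [← ENNReal.ofReal_ofNat]; exact ENNReal.ofReal_le_ofReal hp2
  have happ : ∀ n : ℕ, ∃ u : EuclideanSpace ℝ (Fin d) → ℝ, ContDiff ℝ ∞ u ∧ HasCompactSupport u ∧
      eLpNorm (fun x => u x - f x) 2 (normalizedGaussian d) ≤ ((n : ℝ≥0∞) + 1)⁻¹ ∧
      eLpNorm (fun x => gradient u x - g x) 2 (normalizedGaussian d) ≤ ((n : ℝ≥0∞) + 1)⁻¹ :=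
    fun n => h.exists_contDiff_approx_gaussian hf hg (ENNReal.inv_pos.2 (by simp))
  choose u hu hus h1 h2 using happ
  have hlim : Tendsto (fun n : ℕ => ((n : ℝ≥0∞) + 1)⁻¹) atTop (𝓝 0) := by
    have := (tendsto_add_atTop_iff_nat 1).2 ENNReal.tendsto_inv_nat_nhds_zero
    simpa using this
  have l1 : Tendsto (fun n => eLpNorm (fun x => u n x - f x) 2 (normalizedGaussian d)) atTop
      (𝓝 0) := tendsto_of_tendsto_of_tendsto_of_le_of_le tendsto_const_nhds hlim
    (fun _ => zero_le) h1
  have l2 : Tendsto (fun n => eLpNorm (fun x => gradient (u n) x - g x) 2 (normalizedGaussian d))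
      atTop (𝓝 0) := tendsto_of_tendsto_of_tendsto_of_le_of_le tendsto_const_nhds hlim
    (fun _ => zero_le) h2
  have hgc : ∀ n, Continuous (gradient (u n)) := fun n =>
    (InnerProductSpace.toDual ℝ _).symm.continuous.comp ((hu n).continuous_fderiv (by simp))
  have hgs : ∀ n, HasCompactSupport (gradient (u n)) := fun n =>
    ((hus n).fderiv ℝ).comp_left (g := (InnerProductSpace.toDual ℝ _).symm) (map_zero _)
  have mu : ∀ n q, MemLp (u n) q (normalizedGaussian d) := fun n q =>
    (hu n).continuous.memLp_of_hasCompactSupport (hus n)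
  have mg : ∀ n, MemLp (gradient (u n)) 2 (normalizedGaussian d) := fun n =>
    (hgc n).memLp_of_hasCompactSupport (hgs n)
  have lp : Tendsto (fun n => eLpNorm (fun x => u n x - f x) (ENNReal.ofReal p)
      (normalizedGaussian d)) atTop (𝓝 0) :=
    tendsto_of_tendsto_of_tendsto_of_le_of_le tendsto_const_nhds l1 (fun _ => zero_le)
      fun n => eLpNorm_le_eLpNorm_of_exponent_le hq2 ((mu n 2).sub hf).1
  have mx : ∀ j : Fin d, MemLp (fun x : EuclideanSpace ℝ (Fin d) => x j) 2
      (normalizedGaussian d) := fun j =>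
    memLp_norm_normalizedGaussian.mono' (by fun_prop)
      (ae_of_all _ fun x => PiLp.norm_apply_le x j)
  have lx : ∀ j : Fin d, Tendsto (fun n => ∫ x, u n x * x j ∂(normalizedGaussian d)) atTop
      (𝓝 0) := by
    intro j
    rw [← horth j]
    refine tendsto_integral_of_L1' _ (hf.integrable_mul (mx j)).1
      (Eventually.of_forall fun n => (mu n 2).integrable_mul (mx j)) ?_
    have hz : Tendsto (fun n => eLpNorm (fun x => u n x - f x) 2 (normalizedGaussian d) *
        eLpNorm (fun x : EuclideanSpace ℝ (Fin d) => x j) 2 (normalizedGaussian d)) atTop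
        (𝓝 0) := by
      simpa using ENNReal.Tendsto.mul_const l1 (Or.inr (mx j).eLpNorm_ne_top)
    refine tendsto_of_tendsto_of_tendsto_of_le_of_le tendsto_const_nhds hz (fun _ => zero_le)
      fun n => ?_
    have := eLpNorm_smul_le_mul_eLpNorm (p := 2) (q := 2) (r := 1) (mx j).1 ((mu n 2).sub hf).1
    refine le_trans (le_of_eq ?_) this
    congr 1
    funext x
    simp [sub_mul]
  have t1 := tendsto_lpNorm_of_tendsto_eLpNorm_sub (by norm_num) (fun n => mu n 2) hf l1
  have t2 := tendsto_lpNorm_of_tendsto_eLpNorm_sub hq1 (fun n => mu n _) (hf.mono_exponent hq2) lp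
  have t3 := tendsto_lpNorm_of_tendsto_eLpNorm_sub (by norm_num) mg hg l2
  have rhs := ((t3.pow 2).const_mul (p * (2 - p) / 2)).add
    ((tendsto_finsetSum Finset.univ fun j _ => (lx j).pow 2).const_mul ((2 - p) ^ 2 / 2))
  simp only [ne_eq, OfNat.ofNat_ne_zero, not_false_eq_true, zero_pow, Finset.sum_const_zero,
    mul_zero, add_zero] at rhs
  refine le_of_tendsto_of_tendsto ((t1.pow 2).sub (t2.pow 2)) rhs (Eventually.of_forall fun n => ?_)
  have hn := gaussian_beckner_of_contDiff hp1 hp2 (hu n) (hus n)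
  simp only
  rw [lpNorm_two_sq (mu n 2).1, lpNorm_two_sq (mg n).1, lpNorm_eq_integral_norm_rpow_toReal
    (by simpa using hp0) (by simp) (mu n 2).1, ENNReal.toReal_ofReal hp0.le]
  simpa using hn

end Limit

/-- In the conclusion `gradf` is the weak gradient of `f`, which is unique almost everywhere. -/
theorem theoremA1 (d : ℕ) (hd : 1 ≤ d) (p : ℝ) (hp1 : 1 ≤ p) (hp2 : p < 2)
    (f : EuclideanSpace ℝ (Fin d) → ℝ) (hf : MemGaussianH1 f)
    (gradf : EuclideanSpace ℝ (Fin d) → EuclideanSpace ℝ (Fin d))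
    (hgradf : HasWeakGradient f gradf)
    (horth : ∫ x, f x • x ∂(normalizedGaussian d) = 0) :
    lpNorm gradf 2 (normalizedGaussian d) ^ 2
        - 1 / (2 - p) * (lpNorm f 2 (normalizedGaussian d) ^ 2
            - lpNorm f (ENNReal.ofReal p) (normalizedGaussian d) ^ 2)
      ≥ (2 - p) / 2 * lpNorm gradf 2 (normalizedGaussian d) ^ 2 := by
  obtain ⟨hf2, g, hg, hg2⟩ := hf
  have hgradf2 : MemLp gradf 2 (normalizedGaussian d) :=
    hg2.ae_eq (ae_normalizedGaussian_of_ae_volume (hg.ae_eq hgradf))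
  have hint : Integrable (fun x => f x • x) (normalizedGaussian d) := by
    refine (hf2.norm.integrable_mul memLp_norm_normalizedGaussian).mono'
      (hf2.1.smul (by fun_prop)) (ae_of_all _ fun x => ?_)
    rw [norm_smul, Pi.mul_apply]
  have horth' : ∀ j, ∫ x, f x * x j ∂(normalizedGaussian d) = 0 := by
    intro j
    have := integral_inner (𝕜 := ℝ) hint (EuclideanSpace.single j (1 : ℝ))
    rw [horth, inner_zero_right] at this
    simpa [inner_smul_right, EuclideanSpace.inner_single_left] using this
  have key := gaussian_beckner hp1 hp2.le hgradf hf2 hgradf2 horth'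
  have h2p : 0 < 2 - p := by linarith
  have h := mul_le_mul_of_nonneg_left key (one_div_nonneg.2 h2p.le)
  have e : 1 / (2 - p) * (p * (2 - p) / 2 * lpNorm gradf 2 (normalizedGaussian d) ^ 2) =
      p / 2 * lpNorm gradf 2 (normalizedGaussian d) ^ 2 := by
    field_simp
  rw [e] at h
  linarith
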